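/- Let $D\subset\mathbb R^2$ be the closed unit disk and let $\mathrm{Homeo}(D,\partial D)$ be the group of homeomorphisms of $D$ that fix every point of $\partial D$. Consider the following homeomorphisms of the plane: $$\alpha(x,y)=(x+\tfrac1{12},y),\quad \beta(x,y)=(x,y+\tfrac1{12}),\quad \gamma(x,y)=(x,y+\tfrac1{168}\gamma_0(x)),\quad \delta(x,y)=(\delta_0(x),y),$$ where $\gamma_0:\mathbb R\to\mathbb R$ is the $1$-periodic function with $\gamma_0(x)=-4x+1$ on $[0,\tfrac12)$ and $\gamma_0(x)=4x-3$ on $[\tfrac12,1)$, and $\delta_0:\mathbb R\to\mathbb R$ is the increasing homeomorphism with $\delta_0(x+\tfrac12)=\delta_0^{-1}(x)+\tfrac12$ for all $x$, $\delta_0(x)=\tfrac12x$ on $[0,\tfrac13)$ and $\delta_0(x)=2x-\tfrac12$ on $[\tfrac13,\tfrac12)$. Let also $\bar\gamma=\eta\gamma\eta$ and $\bar\delta=\eta\delta\eta$, where $\eta(x,y)=(y,x)$. These six homeomorphisms have bounded displacement; identifying $\mathbb R^2$ with the interior of $D$ by $w\mapsto w/\sqrt{1+\|w\|^2}$ and extending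 by the identity on $\partial D$, we regard them as elements of $\mathrm{Homeo}(D,\partial D)$. Then each of $\alpha,\beta,\gamma,\delta,\bar\gamma,\bar\delta$ has a square root in $\mathrm{Homeo}(D,\partial D)$, that is, an element whose square is the given one. Moreover, for every choice of one square root in $\mathrm{Homeo}(D,\partial D)$ of each of these six elements, the finitely generated subgroup $\widetilde G\le\mathrm{Homeo}(D,\partial D)$ generated by the six square roots does not embed into the group $\mathrm{Homeo}(\mathbb S^1)$ of all homeomorphisms of the circle (preserving orientation or not): there is no injective group homomorphism $\widetilde G\to\mathrm{Homeo}(\mathbb S^1)$. -/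

import Mathlib

/-- The Euclidean plane. -/
abbrev Plane : Type := EuclideanSpace ℝ (Fin 2)

/-- The closed unit disk `D` of the plane. -/
abbrev Disk : Type := Metric.closedBall (0 : Plane) 1

/-- The group `Homeo(D, ∂D)` of the homeomorphisms of the closed unit disk that fix every point of
the boundary circle, as a subgroup of the group of all homeomorphisms of the disk. -/
def homeoDiskRelBoundary : Subgroup (Disk ≃ₜ Disk) where
  carrier := {h | ∀ z : Disk, ‖(z : Plane)‖ = 1 → h z = z}
  one_mem' := fun _ _ => rfl
  mul_mem' := by
    intro f g hf hg z hz
    change f (g z) = z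
    rw [hg z hz, hf z hz]
  inv_mem' := by
    intro f hf z hz
    change f.symm z = z
    rw [Homeomorph.symm_apply_eq, hf z hz]

/-! ### The planar homeomorphisms -/

/-- The horizontal translation `a^t (x, y) = (x + t, y)`. -/
noncomputable def translateX (t : ℝ) : Plane ≃ₜ Plane where
  toFun w := !₂[w 0 + t, w 1]
  invFun w := !₂[w 0 - t, w 1]
  left_inv w := by ext i; fin_cases i <;> simp
  right_inv w := by ext i; fin_cases i <;> simp
  continuous_toFun := by
    refine (PiLp.continuous_toLp 2 _).comp (continuous_pi fun i => ?_)
    fin_cases i <;> simp <;> fun_prop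
  continuous_invFun := by
    refine (PiLp.continuous_toLp 2 _).comp (continuous_pi fun i => ?_)
    fin_cases i <;> simp <;> fun_prop

/-- The vertical translation `b^t (x, y) = (x, y + t)`. -/
noncomputable def translateY (t : ℝ) : Plane ≃ₜ Plane where
  toFun w := !₂[w 0, w 1 + t]
  invFun w := !₂[w 0, w 1 - t]
  left_inv w := by ext i; fin_cases i <;> simp
  right_inv w := by ext i; fin_cases i <;> simp
  continuous_toFun := by
    refine (PiLp.continuous_toLp 2 _).comp (continuous_pi fun i => ?_)
    fin_cases i <;> simp <;> fun_prop
  continuous_invFun := by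
    refine (PiLp.continuous_toLp 2 _).comp (continuous_pi fun i => ?_)
    fin_cases i <;> simp <;> fun_prop

/-- The restriction of `gamma0` to the period `[0, 1)`. -/
noncomputable def gamma0Period (x : ℝ) : ℝ := if x < 1 / 2 then -4 * x + 1 else 4 * x - 3

/-- The `1`-periodic function equal to `-4x + 1` on `[0, 1/2)` and to `4x - 3` on `[1/2, 1)`. -/
noncomputable def gamma0 (x : ℝ) : ℝ := gamma0Period (Int.fract x)

theorem continuous_gamma0 : Continuous gamma0 := by
  have h : Continuous gamma0Period := by
    unfold gamma0Period
    refine (by fun_prop : Continuous fun u : ℝ => |4 * u - 2| - 1).congr fun u => ?_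
    split_ifs with hu
    · rw [abs_of_nonpos (by linarith)]; ring
    · rw [abs_of_nonneg (by linarith)]; ring
  exact ContinuousOn.comp_fract'' (f := gamma0Period) h.continuousOn
    (by norm_num [gamma0Period])

theorem abs_gamma0_le (x : ℝ) : |gamma0 x| ≤ 1 := by
  have h0 := Int.fract_nonneg x
  have h1 := Int.fract_lt_one x
  rw [gamma0, gamma0Period, abs_le]
  split_ifs <;> constructor <;> linarith

/-- The vertical shear `c^t (x, y) = (x, y + t γ₀(x))`. -/
noncomputable def shear (t : ℝ) : Plane ≃ₜ Plane where
  toFun w := !₂[w 0, w 1 + t * gamma0 (w 0)]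
  invFun w := !₂[w 0, w 1 - t * gamma0 (w 0)]
  left_inv w := by ext i; fin_cases i <;> simp
  right_inv w := by ext i; fin_cases i <;> simp
  continuous_toFun := by
    have := continuous_gamma0
    refine (PiLp.continuous_toLp 2 _).comp (continuous_pi fun i => ?_)
    fin_cases i <;> simp <;> fun_prop
  continuous_invFun := by
    have := continuous_gamma0
    refine (PiLp.continuous_toLp 2 _).comp (continuous_pi fun i => ?_)
    fin_cases i <;> simp <;> fun_prop

/-- The map `delta0` on the period `[0, 1)`. The values on `[1/2, 1)` are forced by the values on
`[0, 1/2)` and the rule `δ₀(x + 1/2) = δ₀⁻¹(x) + 1/2` (see `delta0_add_half`). -/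
noncomputable def delta0Period (x : ℝ) : ℝ :=
  if x < 1 / 3 then x / 2 else if x < 2 / 3 then 2 * x - 1 / 2 else x / 2 + 1 / 2

/-- The inverse of `delta0Period` on `[0, 1)`. -/
noncomputable def delta0InvPeriod (x : ℝ) : ℝ :=
  if x < 1 / 6 then 2 * x else if x < 5 / 6 then x / 2 + 1 / 4 else 2 * x - 1

theorem floor_add_of_mem {n : ℤ} {u : ℝ} (h0 : 0 ≤ u) (h1 : u < 1) :
    ⌊(n : ℝ) + u⌋ = n ∧ Int.fract ((n : ℝ) + u) = u := by
  constructor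
  · rw [Int.floor_eq_iff]; constructor <;> linarith
  · rw [Int.fract_intCast_add, Int.fract_eq_self]; exact ⟨h0, h1⟩

/-- The increasing homeomorphism `δ₀` of the line that commutes with `x ↦ x + 1`, is `x / 2` on
`[0, 1/3)` and `2x - 1/2` on `[1/3, 1/2)`, and satisfies `δ₀(x + 1/2) = δ₀⁻¹(x) + 1/2`. -/
noncomputable def delta0 : ℝ ≃ₜ ℝ where
  toFun x := ⌊x⌋ + delta0Period (Int.fract x)
  invFun x := ⌊x⌋ + delta0InvPeriod (Int.fract x)
  left_inv x := by
    have h0 := Int.fract_nonneg x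
    have h1 := Int.fract_lt_one x
    have hx := Int.floor_add_fract x
    have := floor_add_of_mem (n := ⌊x⌋) (u := delta0Period (Int.fract x))
      (by unfold delta0Period; split_ifs <;> linarith)
      (by unfold delta0Period; split_ifs <;> linarith)
    dsimp only
    rw [this.1, this.2]
    unfold delta0Period delta0InvPeriod
    split_ifs <;> linarith
  right_inv x := by
    have h0 := Int.fract_nonneg x
    have h1 := Int.fract_lt_one x
    have hx := Int.floor_add_fract x
    have := floor_add_of_mem (n := ⌊x⌋) (u := delta0InvPeriod (Int.fract x))
      (by unfold delta0InvPeriod; split_ifs <;> linarith)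
      (by unfold delta0InvPeriod; split_ifs <;> linarith)
    dsimp only
    rw [this.1, this.2]
    unfold delta0Period delta0InvPeriod
    split_ifs <;> linarith
  continuous_toFun := by
    have h : Continuous fun u : ℝ => max (u / 2) (min (2 * u - 1 / 2) (u / 2 + 1 / 2)) - u := by
      fun_prop
    refine (continuous_id.add (ContinuousOn.comp_fract'' h.continuousOn (by norm_num))).congr ?_
    intro x
    have h0 := Int.fract_nonneg x
    have h1 := Int.fract_lt_one x
    have hx := Int.floor_add_fract x
    change x + (max (Int.fract x / 2) (min (2 * Int.fract x - 1 / 2) (Int.fract x / 2 + 1 / 2))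
      - Int.fract x) = ⌊x⌋ + delta0Period (Int.fract x)
    unfold delta0Period
    split_ifs <;> grind
  continuous_invFun := by
    have h : Continuous fun u : ℝ => min (2 * u) (max (u / 2 + 1 / 4) (2 * u - 1)) - u := by
      fun_prop
    refine (continuous_id.add (ContinuousOn.comp_fract'' h.continuousOn (by norm_num))).congr ?_
    intro x
    have h0 := Int.fract_nonneg x
    have h1 := Int.fract_lt_one x
    have hx := Int.floor_add_fract x
    change x + (min (2 * Int.fract x) (max (Int.fract x / 2 + 1 / 4) (2 * Int.fract x - 1))
      - Int.fract x) = ⌊x⌋ + delta0InvPeriod (Int.fract x)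
    unfold delta0InvPeriod
    split_ifs <;> grind

theorem delta0_of_lt_third {x : ℝ} (h0 : 0 ≤ x) (h1 : x < 1 / 3) : delta0 x = x / 2 := by
  have hf := floor_add_of_mem (n := 0) h0 (by linarith : x < 1)
  simp only [Int.cast_zero, zero_add] at hf
  change ((⌊x⌋ : ℤ) : ℝ) + delta0Period (Int.fract x) = _
  rw [hf.1, hf.2, delta0Period, if_pos h1]
  simp

theorem delta0_of_lt_half {x : ℝ} (h0 : 1 / 3 ≤ x) (h1 : x < 1 / 2) :
    delta0 x = 2 * x - 1 / 2 := by
  have hf := floor_add_of_mem (n := 0) (by linarith : 0 ≤ x) (by linarith : x < 1)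
  simp only [Int.cast_zero, zero_add] at hf
  change ((⌊x⌋ : ℤ) : ℝ) + delta0Period (Int.fract x) = _
  rw [hf.1, hf.2, delta0Period, if_neg (by linarith), if_pos (by linarith)]
  simp

theorem delta0_add_half (x : ℝ) : delta0 (x + 1 / 2) = delta0.symm x + 1 / 2 := by
  have h0 := Int.fract_nonneg x
  have h1 := Int.fract_lt_one x
  have hx := Int.floor_add_fract x
  change ((⌊x + 1 / 2⌋ : ℤ) : ℝ) + delta0Period (Int.fract (x + 1 / 2)) =
    ((⌊x⌋ : ℤ) : ℝ) + delta0InvPeriod (Int.fract x) + 1 / 2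
  by_cases h : Int.fract x < 1 / 2
  · have hf := floor_add_of_mem (n := ⌊x⌋) (u := Int.fract x + 1 / 2) (by linarith) (by linarith)
    rw [show x + 1 / 2 = (⌊x⌋ : ℝ) + (Int.fract x + 1 / 2) by linarith, hf.1, hf.2]
    unfold delta0Period delta0InvPeriod
    split_ifs <;> linarith
  · have hf := floor_add_of_mem (n := ⌊x⌋ + 1) (u := Int.fract x - 1 / 2)
      (by linarith) (by linarith)
    rw [show x + 1 / 2 = ((⌊x⌋ + 1 : ℤ) : ℝ) + (Int.fract x - 1 / 2) by push_cast; linarith,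
      hf.1, hf.2]
    unfold delta0Period delta0InvPeriod
    push_cast
    split_ifs <;> linarith

theorem abs_delta0_sub_le (x : ℝ) : |delta0 x - x| ≤ 1 := by
  have h0 := Int.fract_nonneg x
  have h1 := Int.fract_lt_one x
  have hx := Int.floor_add_fract x
  change |((⌊x⌋ : ℤ) : ℝ) + delta0Period (Int.fract x) - x| ≤ 1
  rw [delta0Period, abs_le]
  split_ifs <;> constructor <;> linarith

/-- The homeomorphism `(x, y) ↦ (δ₀(x), y)`. -/
noncomputable def deltaMap : Plane ≃ₜ Plane where
  toFun w := !₂[delta0 (w 0), w 1]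
  invFun w := !₂[delta0.symm (w 0), w 1]
  left_inv w := by ext i; fin_cases i <;> simp
  right_inv w := by ext i; fin_cases i <;> simp
  continuous_toFun := by
    refine (PiLp.continuous_toLp 2 _).comp (continuous_pi fun i => ?_)
    fin_cases i <;> simp <;> fun_prop
  continuous_invFun := by
    refine (PiLp.continuous_toLp 2 _).comp (continuous_pi fun i => ?_)
    fin_cases i <;> simp <;> fun_prop

/-- The involution `η (x, y) = (y, x)`. -/
noncomputable def swapMap : Plane ≃ₜ Plane where
  toFun w := !₂[w 1, w 0]
  invFun w := !₂[w 1, w 0]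
  left_inv w := by ext i; fin_cases i <;> simp
  right_inv w := by ext i; fin_cases i <;> simp
  continuous_toFun := by
    refine (PiLp.continuous_toLp 2 _).comp (continuous_pi fun i => ?_)
    fin_cases i <;> simp <;> fun_prop
  continuous_invFun := by
    refine (PiLp.continuous_toLp 2 _).comp (continuous_pi fun i => ?_)
    fin_cases i <;> simp <;> fun_prop

/-- The six planar homeomorphisms `α = a^{1/12}`, `β = b^{1/12}`, `γ = c^{1/168}`, `δ`,
`ηγη` and `ηδη`. -/
noncomputable def planarGenerator : Fin 6 → (Plane ≃ₜ Plane) :=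
  ![translateX (1 / 12), translateY (1 / 12), shear (1 / 168), deltaMap,
    swapMap * shear (1 / 168) * swapMap, swapMap * deltaMap * swapMap]

/-! ### From the plane to the disk -/

/-- `f` moves all points of the plane by a bounded distance. -/
def BoundedDisplacement (f : Plane ≃ₜ Plane) : Prop := ∃ C : ℝ, ∀ w, ‖f w - w‖ ≤ C

theorem BoundedDisplacement.symm {f : Plane ≃ₜ Plane} (hf : BoundedDisplacement f) :
    BoundedDisplacement f.symm := by
  obtain ⟨C, hC⟩ := hf
  refine ⟨C, fun w => ?_⟩
  have := hC (f.symm w)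
  rwa [f.apply_symm_apply, norm_sub_rev] at this

theorem boundedDisplacement_planarGenerator (i : Fin 6) :
    BoundedDisplacement (planarGenerator i) := by
  refine ⟨1, fun w => ?_⟩
  have hx : ∀ v : Plane, |v 0| ≤ 1 → v 1 = 0 → ‖v‖ ≤ 1 := by
    intro v h0 h1
    rw [EuclideanSpace.norm_eq, Fin.sum_univ_two, h1]
    simpa [Real.sqrt_sq_eq_abs] using h0
  have hy : ∀ v : Plane, v 0 = 0 → |v 1| ≤ 1 → ‖v‖ ≤ 1 := by
    intro v h0 h1
    rw [EuclideanSpace.norm_eq, Fin.sum_univ_two, h0]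
    simpa [Real.sqrt_sq_eq_abs] using h1
  have hg : ∀ x, |1 / 168 * gamma0 x| ≤ 1 := by
    intro x
    have := abs_le.mp (abs_gamma0_le x)
    rw [abs_le]; constructor <;> linarith
  fin_cases i
  · refine hx _ ?_ ?_ <;> simp [planarGenerator, translateX]
    norm_num [abs_le]
  · refine hy _ ?_ ?_ <;> simp [planarGenerator, translateY]
    norm_num [abs_le]
  · refine hy _ ?_ ?_ <;> simp [planarGenerator, shear]
    simpa using hg (w 0)
  · refine hx _ ?_ ?_ <;> simp [planarGenerator, deltaMap]
    exact abs_delta0_sub_le _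
  · refine hx _ ?_ ?_ <;> simp [planarGenerator, shear, swapMap, Homeomorph.mul_apply]
    simpa using hg (w 1)
  · refine hy _ ?_ ?_ <;> simp [planarGenerator, deltaMap, swapMap, Homeomorph.mul_apply]
    exact abs_delta0_sub_le _

/-- The radial identification `w ↦ w / √(1 + ‖w‖²)` of the plane with the open unit disk. -/
noncomputable def toDisk (w : Plane) : Plane := (√(1 + ‖w‖ ^ 2))⁻¹ • w

/-- The inverse `z ↦ z / √(1 - ‖z‖²)` of `toDisk` on the open unit disk. -/
noncomputable def ofDisk (z : Plane) : Plane := (√(1 - ‖z‖ ^ 2))⁻¹ • z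

theorem norm_toDisk_lt (w : Plane) : ‖toDisk w‖ < 1 :=
  mem_ball_zero_iff.mp (OpenPartialHomeomorph.univUnitBall.map_source' (x := w) (Set.mem_univ _))

theorem ofDisk_toDisk (w : Plane) : ofDisk (toDisk w) = w :=
  OpenPartialHomeomorph.univUnitBall.left_inv' (x := w) (Set.mem_univ _)

theorem toDisk_ofDisk {z : Plane} (hz : ‖z‖ < 1) : toDisk (ofDisk z) = z :=
  OpenPartialHomeomorph.univUnitBall.right_inv' (x := z)
    (mem_ball_zero_iff.mpr hz)

theorem continuous_toDisk : Continuous toDisk :=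
  continuousOn_univ.mp OpenPartialHomeomorph.univUnitBall.continuousOn_toFun

theorem continuousOn_ofDisk : ContinuousOn ofDisk (Metric.ball 0 1) :=
  OpenPartialHomeomorph.univUnitBall.continuousOn_invFun

theorem norm_toDisk_sub_le (v w : Plane) :
    ‖toDisk v - toDisk w‖ ≤ 2 * ((√(1 + ‖w‖ ^ 2))⁻¹ * ‖v - w‖) := by
  set a := √(1 + ‖v‖ ^ 2) with ha
  set b := √(1 + ‖w‖ ^ 2) with hb
  have ha2 : a ^ 2 = 1 + ‖v‖ ^ 2 := Real.sq_sqrt (by positivity)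
  have hb2 : b ^ 2 = 1 + ‖w‖ ^ 2 := Real.sq_sqrt (by positivity)
  have ha0 : 0 < a := Real.sqrt_pos.mpr (by positivity)
  have hb0 : 0 < b := Real.sqrt_pos.mpr (by positivity)
  have hva : ‖v‖ ≤ a := by nlinarith [norm_nonneg v]
  have hwb : ‖w‖ ≤ b := by nlinarith [norm_nonneg w]
  have hab : |b - a| ≤ ‖v - w‖ := by
    have h1 : |b - a| * (b + a) = |‖w‖ - ‖v‖| * (‖w‖ + ‖v‖) := by
      have e1 : |b - a| * |b + a| = |‖w‖ - ‖v‖| * |‖w‖ + ‖v‖| := by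
        rw [← abs_mul, ← abs_mul]
        congr 1
        linarith [sq_sub_sq b a, sq_sub_sq ‖w‖ ‖v‖]
      rwa [abs_of_pos (by positivity : 0 < b + a),
        abs_of_nonneg (by positivity : 0 ≤ ‖w‖ + ‖v‖)] at e1
    have h2 : |‖w‖ - ‖v‖| ≤ ‖v - w‖ := by
      rw [norm_sub_rev]; exact abs_norm_sub_norm_le w v
    have h3 : |b - a| * (b + a) ≤ ‖v - w‖ * (b + a) := by
      rw [h1]
      exact mul_le_mul h2 (by linarith) (by positivity) (norm_nonneg _)
    exact le_of_mul_le_mul_right h3 (by positivity)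
  have e : toDisk v - toDisk w = b⁻¹ • (v - w) + (b⁻¹ * (b - a)) • (a⁻¹ • v) := by
    unfold toDisk
    rw [← ha, ← hb, smul_smul, smul_sub,
      show b⁻¹ * (b - a) * a⁻¹ = a⁻¹ - b⁻¹ by field_simp, sub_smul]
    abel
  have h1 : ‖a⁻¹ • v‖ ≤ 1 := (norm_toDisk_lt v).le
  rw [e]
  refine (norm_add_le _ _).trans ?_
  rw [norm_smul, norm_smul (b⁻¹ * (b - a)), norm_mul, Real.norm_eq_abs, Real.norm_eq_abs,
    abs_of_pos (inv_pos.mpr hb0)]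
  have h4 : b⁻¹ * |b - a| * ‖a⁻¹ • v‖ ≤ b⁻¹ * ‖v - w‖ * 1 := by gcongr
  linarith

/-- The map of the plane that is `f` on the open unit disk, seen as the plane through `toDisk`, and
the identity elsewhere. -/
noncomputable def diskMap (f : Plane ≃ₜ Plane) (z : Plane) : Plane :=
  if ‖z‖ < 1 then toDisk (f (ofDisk z)) else z

theorem diskMap_of_lt (f : Plane ≃ₜ Plane) {z : Plane} (hz : ‖z‖ < 1) :
    diskMap f z = toDisk (f (ofDisk z)) := if_pos hz

theorem diskMap_of_not_lt (f : Plane ≃ₜ Plane) {z : Plane} (hz : ¬ ‖z‖ < 1) :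
    diskMap f z = z := if_neg hz

theorem diskMap_mem (f : Plane ≃ₜ Plane) (z : Disk) :
    diskMap f z ∈ Metric.closedBall (0 : Plane) 1 := by
  by_cases hz : ‖(z : Plane)‖ < 1
  · rw [diskMap_of_lt f hz, mem_closedBall_zero_iff]
    exact (norm_toDisk_lt _).le
  · rw [diskMap_of_not_lt f hz]
    exact z.2

theorem diskMap_symm_diskMap (f : Plane ≃ₜ Plane) (z : Plane) :
    diskMap f.symm (diskMap f z) = z := by
  by_cases hz : ‖z‖ < 1
  · rw [diskMap_of_lt f hz, diskMap_of_lt _ (norm_toDisk_lt _), ofDisk_toDisk,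
      f.symm_apply_apply, toDisk_ofDisk hz]
  · rw [diskMap_of_not_lt f hz, diskMap_of_not_lt _ hz]

theorem continuous_diskMap {f : Plane ≃ₜ Plane} (hf : BoundedDisplacement f) :
    Continuous fun z : Disk => diskMap f z := by
  obtain ⟨C, hC⟩ := hf
  have bound : ∀ z : Disk, ‖diskMap f z - z‖ ≤ 2 * (√(1 - ‖(z : Plane)‖ ^ 2) * C) := by
    intro z
    have hz1 : ‖(z : Plane)‖ ≤ 1 := mem_closedBall_zero_iff.mp z.2
    have hC0 : 0 ≤ C := (norm_nonneg _).trans (hC 0)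
    by_cases hz : ‖(z : Plane)‖ < 1
    · have h := norm_toDisk_sub_le (f (ofDisk z)) (ofDisk z)
      rw [toDisk_ofDisk hz] at h
      have hpos : 0 < 1 - ‖(z : Plane)‖ ^ 2 := by nlinarith [norm_nonneg (z : Plane)]
      have h2 : (√(1 + ‖ofDisk z‖ ^ 2))⁻¹ = √(1 - ‖(z : Plane)‖ ^ 2) := by
        rw [← Real.sqrt_inv]
        congr 1
        rw [ofDisk, norm_smul, mul_pow, norm_inv, Real.norm_eq_abs, inv_pow, sq_abs,
          Real.sq_sqrt hpos.le]
        field_simp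
        ring
      rw [diskMap_of_lt f hz]
      rw [h2] at h
      refine h.trans ?_
      have := hC (ofDisk z)
      gcongr
    · rw [diskMap_of_not_lt f hz, sub_self, norm_zero]
      positivity
  rw [continuous_iff_continuousAt]
  intro z
  by_cases hz : ‖(z : Plane)‖ < 1
  · have hball : Metric.ball (0 : Plane) 1 ∈ nhds (z : Plane) :=
      Metric.isOpen_ball.mem_nhds (by simpa using hz)
    have hc : ContinuousAt (fun y : Plane => toDisk (f (ofDisk y))) (z : Plane) :=
      continuous_toDisk.continuousAt.comp
        (f.continuous.continuousAt.comp (continuousOn_ofDisk.continuousAt hball))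
    have hc2 : ContinuousAt (diskMap f) (z : Plane) := by
      refine hc.congr ?_
      filter_upwards [hball] with y hy
      exact (diskMap_of_lt f (by simpa using hy)).symm
    exact hc2.comp continuous_subtype_val.continuousAt
  · have hz1 : ‖(z : Plane)‖ = 1 :=
      le_antisymm (mem_closedBall_zero_iff.mp z.2) (not_lt.mp hz)
    have hlim : Filter.Tendsto (fun y : Disk => diskMap f y - y) (nhds z) (nhds 0) := by
      refine squeeze_zero_norm bound ?_
      have hcont : Continuous fun y : Disk => 2 * (√(1 - ‖(y : Plane)‖ ^ 2) * C) := by fun_prop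
      have := hcont.tendsto z
      simpa [hz1] using this
    have h := hlim.add (continuous_subtype_val.tendsto z)
    simp only [sub_add_cancel, zero_add] at h
    have e : diskMap f z = z := diskMap_of_not_lt f hz
    rw [← e] at h
    exact h

/-- A homeomorphism of the plane with bounded displacement, seen as an element of `Homeo(D, ∂D)`:
the plane is identified with the open disk by `toDisk`, and the boundary is fixed pointwise. -/
noncomputable def toHomeoDisk (f : Plane ≃ₜ Plane) (hf : BoundedDisplacement f) :
    homeoDiskRelBoundary where
  val :=
    { toFun := fun z => ⟨diskMap f z, diskMap_mem f z⟩
      invFun := fun z => ⟨diskMap f.symm z, diskMap_mem f.symm z⟩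
      left_inv := fun z => Subtype.ext (diskMap_symm_diskMap f z)
      right_inv := fun z => Subtype.ext (by simpa using diskMap_symm_diskMap f.symm z)
      continuous_toFun := (continuous_diskMap hf).subtype_mk _
      continuous_invFun := (continuous_diskMap hf.symm).subtype_mk _ }
  property := fun _ hz => Subtype.ext (diskMap_of_not_lt f (by rw [hz]; exact lt_irrefl 1))

/-- The six elements `α, β, γ, δ, ηγη, ηδη` of `Homeo(D, ∂D)`. -/
noncomputable def diskGenerator (i : Fin 6) : homeoDiskRelBoundary :=
  toHomeoDisk (planarGenerator i) (boundedDisplacement_planarGenerator i)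

/-!
Write `α, β, γ, δ` for the generators and suppose that the group generated by their square roots
acts faithfully on the circle. Then each generator acts by a square, hence preserves orientation and
lifts to the line. The map `α ^ 6`, translation by `1 / 2`, conjugates `γ` and `δ` to their
inverses. If a map `s` of the line conjugates `c` to its inverse, then `c` has a fixed point between
`p` and `s p` for every `p`. So, for every lift `s` of `α ^ 6`, suitable lifts of the conjugates of
`γ ^ 2` by words in `α` and `δ`, whose lifts preserve the fixed points of `s`, fix all fixed points
of `s` and some point in each gap between them. Conjugates of `γ ^ 2` are vertical shears; they
commute, also after lifting, because a commutator in the kernel has translation number `0`.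
Therefore they have common fixed points in the gaps of `s`, and so has the product `w` of them that
lifts `β ^ 6`, by the identity `∑ j : Fin 3, (γ₀ (δ₀ (x + j / 3)) - 2 γ₀ (x + j / 3)) = 1`.
Exchanging the coordinates shows that, for a suitable `s`, also `s` has fixed points in the gaps of
`w`. Then `s` is trivial, so `α ^ 6` acts trivially, a contradiction.

The square root of `δ` comes from a square root of `δ₀` among the increasing homeomorphisms of the
line, obtained by interpolating the orbits of `δ₀` to real times.
-/

theorem semiconjBy_inv_mul_sq {G : Type*} [Group G] {s c z : G} (hzs : Commute z s)
    (hzc : Commute z c) (h : SemiconjBy s c (z * c⁻¹)) :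
    SemiconjBy s (z⁻¹ * c ^ 2) (z⁻¹ * c ^ 2)⁻¹ := by
  have hinv : z⁻¹ * (z * c⁻¹) ^ 2 = (z⁻¹ * c ^ 2)⁻¹ := by
    rw [hzc.inv_right.mul_pow, sq z, mul_assoc, inv_mul_cancel_left, mul_inv_rev, inv_inv, inv_pow]
    exact (hzc.pow_right 2).inv_right.eq
  exact hinv ▸ SemiconjBy.mul_right hzs.symm.inv_right (h.pow_right 2)

section OrderDynamics

open Set Function

variable {X : Type*}

theorem eq_of_isFixedPt_of_mem_uIcc [LinearOrder X] {f : X ≃o X} {p q : X}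
    (hq : IsFixedPt f q) (h : q ∈ uIcc p (f p)) : p = q := by
  rcases mem_uIcc.mp h with ⟨hpq, hqp⟩ | ⟨hpq, hqp⟩
  · exact hpq.antisymm (f.le_iff_le.mp (hq.eq.le.trans hqp))
  · exact (f.le_iff_le.mp (hpq.trans hq.eq.ge)).antisymm hqp

section Inversion

variable [ConditionallyCompleteLinearOrder X] [TopologicalSpace X] [OrderTopology X]
  [DenselyOrdered X]

theorem exists_isFixedPt_mem_uIcc_of_semiconjBy_inv {s c : X ≃o X} (h : SemiconjBy s c c⁻¹)
    (p : X) : ∃ x ∈ uIcc p (s p), IsFixedPt c x := by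
  have hflip : c⁻¹ (s p) = s (c p) := (DFunLike.congr_fun h.eq p).symm
  have hcs : c (s (c p)) = s p := by rw [← hflip, RelIso.apply_inv_self]
  rcases le_total p (c p) with hp | hp
  · have hsp : c (s p) ≤ s p := (c.monotone (s.monotone hp)).trans_eq hcs
    exact exists_mem_uIcc_isFixedPt c.continuous.continuousOn hp hsp
  · have hsp : s p ≤ c (s p) := hcs.ge.trans (c.monotone (s.monotone hp))
    exact uIcc_comm p (s p) ▸ exists_mem_uIcc_isFixedPt c.continuous.continuousOn hsp hp

theorem isFixedPt_of_semiconjBy_inv {s c : X ≃o X} (h : SemiconjBy s c c⁻¹) {p : X}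
    (hp : IsFixedPt s p) : IsFixedPt c p := by
  obtain ⟨x, hx, hcx⟩ := exists_isFixedPt_mem_uIcc_of_semiconjBy_inv h p
  rw [hp.eq, uIcc_self, mem_singleton_iff] at hx
  exact hx ▸ hcx

theorem isFixedPt_apply_of_semiconjBy_mul_inv {s d z : X ≃o X} (hzs : Commute z s)
    (hzd : Commute z d) (h : SemiconjBy s d (z * d⁻¹)) {p : X} (hp : IsFixedPt s p) :
    IsFixedPt s (d p) := by
  have hsq : z⁻¹ (d (d p)) = p :=
    isFixedPt_of_semiconjBy_inv (semiconjBy_inv_mul_sq hzs hzd h) hp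
  have hz : (d * z⁻¹) (d p) = p := by rwa [← hzd.inv_left.eq]
  calc s (d p) = z (d⁻¹ (s p)) := DFunLike.congr_fun h.eq p
    _ = z (d⁻¹ p) := by rw [hp.eq]
    _ = z (d⁻¹ (d (z⁻¹ (d p)))) := by rw [← RelIso.mul_apply d, hz]
    _ = d p := by rw [RelIso.inv_apply_self, RelIso.apply_inv_self]

end Inversion

section CommonFixedPoint

variable [ConditionallyCompleteLinearOrder X]

/- The infimum of the orbit of `q` under `k` is fixed by `k`, and by every map commuting with `k`
that fixes `q`. -/
theorem exists_isFixedPt_mem_Icc_of_commute {k : X ≃o X} {p q : X} (hpq : p ≤ q)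
    (hp : IsFixedPt k p) :
    ∃ m ∈ Icc p q, IsFixedPt k m ∧ ∀ h : X ≃o X, Commute h k → IsFixedPt h q → IsFixedPt h m := by
  have hlow (n : ℤ) : p ≤ (k ^ n) q := by
    have hpn : (k ^ n) p = p := zpow_mem (K := MulAction.stabilizer (X ≃o X) p) hp n
    exact hpn.ge.trans ((k ^ n).monotone hpq)
  have hbdd : BddBelow (range fun n : ℤ ↦ (k ^ n) q) := ⟨p, forall_mem_range.mpr hlow⟩
  refine ⟨⨅ n : ℤ, (k ^ n) q, ⟨le_ciInf hlow, ciInf_le hbdd 0⟩, ?_, fun h hk hq ↦ ?_⟩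
  · rw [IsFixedPt, k.map_ciInf hbdd]
    exact (Equiv.addLeft 1).iInf_congr fun n ↦ by
      rw [Equiv.coe_addLeft, zpow_add, zpow_one, RelIso.mul_apply]
  · rw [IsFixedPt, h.map_ciInf hbdd]
    refine iInf_congr fun n ↦ ?_
    rw [← RelIso.mul_apply, (hk.zpow_right n).eq, RelIso.mul_apply, hq.eq]

theorem exists_isFixedPt_mem_uIcc_of_commute {k : X ≃o X} {p : X} (hp : IsFixedPt k p) (q : X) :
    ∃ m ∈ uIcc p q,
      IsFixedPt k m ∧ ∀ h : X ≃o X, Commute h k → IsFixedPt h q → IsFixedPt h m := by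
  rcases le_total p q with hpq | hqp
  · rw [uIcc_of_le hpq]
    exact exists_isFixedPt_mem_Icc_of_commute hpq hp
  · obtain ⟨m, hm, hkm, hcomm⟩ :=
      exists_isFixedPt_mem_Icc_of_commute (X := Xᵒᵈ) (k := k.dual) hqp hp
    exact ⟨m, Icc_subset_uIcc' hm.symm, hkm, fun h hk hq ↦
      hcomm h.dual (congrArg OrderIso.dual hk.eq) hq⟩

theorem exists_common_isFixedPt {ι : Type*} [Finite ι] {h : ι → X ≃o X}
    (hcomm : ∀ i j, Commute (h i) (h j)) {I : Set X} (hI : I.OrdConnected) (hne : I.Nonempty)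
    (hfix : ∀ i, ∃ x ∈ I, IsFixedPt (h i) x) : ∃ x ∈ I, ∀ i, IsFixedPt (h i) x := by
  classical
  cases nonempty_fintype ι
  suffices ∀ t : Finset ι, ∃ x ∈ I, ∀ i ∈ t, IsFixedPt (h i) x by
    simpa only [Finset.mem_univ, forall_const] using this Finset.univ
  intro t
  induction t using Finset.induction_on with
  | empty => exact hne.imp fun _ hx ↦ ⟨hx, fun _ hi ↦ absurd hi (Finset.notMem_empty _)⟩
  | insert j t _ ih =>
    obtain ⟨q, hqI, hq⟩ := ih
    obtain ⟨p, hpI, hp⟩ := hfix j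
    obtain ⟨m, hm, hjm, hcommon⟩ := exists_isFixedPt_mem_uIcc_of_commute hp q
    exact ⟨m, hI.uIcc_subset hpI hqI hm, Finset.forall_mem_insert .. |>.mpr
      ⟨hjm, fun i hi ↦ hcommon _ (hcomm i j) (hq i hi)⟩⟩

end CommonFixedPoint

/-- `f` has fixed points in the gaps of `s` if it fixes every fixed point of `s` and at least one
point of every connected component of the complement of the fixed point set of `s`. Two maps with
this relation in both directions are trivial. -/
structure HasFixedPointsInGaps [LinearOrder X] (s f : X ≃o X) : Prop where
  isFixedPt : ∀ p, IsFixedPt s p → IsFixedPt f p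
  exists_isFixedPt : ∀ p, ¬IsFixedPt s p →
    ∃ x ∈ ordConnectedComponent (fixedPoints s)ᶜ p, IsFixedPt f x

namespace HasFixedPointsInGaps

theorem eq_one [LinearOrder X] {s f : X ≃o X} (hsf : HasFixedPointsInGaps s f)
    (hfs : HasFixedPointsInGaps f s) : s = 1 := by
  ext p
  by_contra hp
  obtain ⟨x, hx, hfx⟩ := hsf.exists_isFixedPt p hp
  exact ordConnectedComponent_subset hx (hfs.isFixedPt x hfx)

theorem of_semiconjBy_inv [ConditionallyCompleteLinearOrder X] [TopologicalSpace X]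
    [OrderTopology X] [DenselyOrdered X] {s c g : X ≃o X} (hc : SemiconjBy s c c⁻¹)
    (hg : MapsTo g (fixedPoints s) (fixedPoints s)) : HasFixedPointsInGaps s (g⁻¹ * c * g) := by
  have hinv : SemiconjBy (g⁻¹ * s * g) (g⁻¹ * c * g) (g⁻¹ * c * g)⁻¹ := by
    have := (SemiconjBy.conj_iff (b := g⁻¹)).mpr hc
    simpa only [inv_inv, mul_inv_rev, mul_assoc] using this
  have hfix (q : X) (hq : IsFixedPt s q) : IsFixedPt (g⁻¹ * s * g) q := by
    have hgq : s (g q) = g q := hg hq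
    rw [IsFixedPt, RelIso.mul_apply, RelIso.mul_apply, hgq, RelIso.inv_apply_self]
  refine ⟨fun p hp ↦ isFixedPt_of_semiconjBy_inv hinv (hfix p hp), fun p hp ↦ ?_⟩
  obtain ⟨x, hx, hcx⟩ := exists_isFixedPt_mem_uIcc_of_semiconjBy_inv hinv p
  refine ⟨x, fun q hq hsq ↦ hp ?_, hcx⟩
  exact (eq_of_isFixedPt_of_mem_uIcc (hfix q hsq) (uIcc_subset_uIcc_left hx hq)) ▸ hsq

theorem of_mem_closure [ConditionallyCompleteLinearOrder X] {ι : Type*} [Finite ι] {s w : X ≃o X}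
    {h : ι → X ≃o X} (hcomm : ∀ i j, Commute (h i) (h j))
    (hh : ∀ i, HasFixedPointsInGaps s (h i)) (hw : w ∈ Subgroup.closure (range h)) :
    HasFixedPointsInGaps s w := by
  have hfix {p : X} (hp : ∀ i, IsFixedPt (h i) p) : IsFixedPt w p :=
    (Subgroup.closure_le (MulAction.stabilizer (X ≃o X) p)).mpr (range_subset_iff.mpr hp) hw
  refine ⟨fun p hp ↦ hfix fun i ↦ (hh i).isFixedPt p hp, fun p hp ↦ ?_⟩
  obtain ⟨x, hx, hcommon⟩ := exists_common_isFixedPt hcomm inferInstance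
    ⟨p, self_mem_ordConnectedComponent.mpr hp⟩ fun i ↦ (hh i).exists_isFixedPt p hp
  exact ⟨x, hx, hfix hcommon⟩

end HasFixedPointsInGaps

end OrderDynamics

/-- The conjugates `g⁻¹ * x * g` of `x` by the six words `g = d ^ k * a ^ (4 * j)`, `k < 2`,
`j < 3`. For the generators, `a ^ 4` is the translation by `1 / 3` and `d` is `δ`, and the six
conjugates of `γ ^ 2` are vertical shears. -/
def towerConj {G : Type*} [Group G] (a d x : G) (i : Fin 2 × Fin 3) : G :=
  (d ^ (i.1 : ℕ) * a ^ (4 * (i.2 : ℕ)))⁻¹ * x * (d ^ (i.1 : ℕ) * a ^ (4 * (i.2 : ℕ)))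

/-- The relations satisfied by the generators `a = α`, `b = β`, `c = γ`, `d = δ` that obstruct an
action on the circle: `a ^ 6` inverts both `c` and `d`, as in the Klein bottle group, and `b ^ 6`
is a product of commuting conjugates of `c ^ 2`. -/
structure KleinSystem {G : Type*} [Group G] (a b c d : G) : Prop where
  semiconjBy_inv : SemiconjBy (a ^ 6) c c⁻¹
  semiconjBy_inv' : SemiconjBy (a ^ 6) d d⁻¹
  commute : ∀ i j, Commute (towerConj a d (c ^ 2) i) (towerConj a d (c ^ 2) j)
  mem_closure : b ^ 6 ∈ Subgroup.closure (Set.range (towerConj a d (c ^ 2)))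

section KleinSystem

variable {G H : Type*} [Group G] [Group H]

theorem map_towerConj (φ : G →* H) (a d x : G) (i : Fin 2 × Fin 3) :
    φ (towerConj a d x i) = towerConj (φ a) (φ d) (φ x) i := by
  simp only [towerConj, map_mul, map_inv, map_pow]

theorem map_closure_range_towerConj (φ : G →* H) (a d x : G) :
    (Subgroup.closure (Set.range (towerConj a d x))).map φ =
      Subgroup.closure (Set.range (towerConj (φ a) (φ d) (φ x))) := by
  rw [MonoidHom.map_closure, ← Set.range_comp]
  exact congrArg (Subgroup.closure ∘ Set.range) (funext (map_towerConj φ a d x))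

theorem kleinSystem_map_iff {φ : G →* H} (hφ : Function.Injective φ) {a b c d : G} :
    KleinSystem (φ a) (φ b) (φ c) (φ d) ↔ KleinSystem a b c d := by
  have hsemi (x : G) : SemiconjBy (φ a ^ 6) (φ x) (φ x)⁻¹ ↔ SemiconjBy (a ^ 6) x x⁻¹ := by
    rw [← map_pow, ← map_inv, semiconjBy_map_iff hφ]
  have hmem : φ b ^ 6 ∈ Subgroup.closure (Set.range (towerConj (φ a) (φ d) (φ c ^ 2))) ↔
      b ^ 6 ∈ Subgroup.closure (Set.range (towerConj a d (c ^ 2))) := by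
    rw [← map_pow, ← map_pow, ← map_closure_range_towerConj, Subgroup.mem_map_iff_mem hφ]
  have hcomm (i j) :
      Commute (towerConj (φ a) (φ d) (φ c ^ 2) i) (towerConj (φ a) (φ d) (φ c ^ 2) j) ↔
        Commute (towerConj a d (c ^ 2) i) (towerConj a d (c ^ 2) j) := by
    rw [← map_pow, ← map_towerConj, ← map_towerConj, commute_map_iff hφ]
  constructor <;> rintro ⟨hc, hd, h, hb⟩
  · exact ⟨(hsemi c).mp hc, (hsemi d).mp hd, fun i j ↦ (hcomm i j).mp (h i j), hmem.mp hb⟩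
  · exact ⟨(hsemi c).mpr hc, (hsemi d).mpr hd, fun i j ↦ (hcomm i j).mpr (h i j), hmem.mpr hb⟩

end KleinSystem

section CircleHomeo

open Function Topology

/-- The universal covering `x ↦ exp (2πix)` of the circle, with deck transformations the integer
translations. -/
noncomputable def circleProj (x : ℝ) : Circle := Circle.exp (2 * Real.pi * x)

theorem circleProj_eq_iff {x y : ℝ} : circleProj x = circleProj y ↔ ∃ k : ℤ, x = y + k := by
  rw [circleProj, circleProj, Circle.exp_eq_exp]
  refine exists_congr fun k ↦ ?_
  rw [mul_comm (k : ℝ), ← mul_add, mul_right_inj' Real.two_pi_pos.ne']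

theorem isCoveringMap_circleProj : IsCoveringMap circleProj :=
  Circle.isCoveringMap_exp.comp_homeomorph (Homeomorph.mulLeft₀ _ Real.two_pi_pos.ne')

theorem circleProj_surjective : Surjective circleProj :=
  Circle.exp_surjective.comp (mul_left_surjective₀ Real.two_pi_pos.ne')

theorem continuous_circleProj : Continuous circleProj := isCoveringMap_circleProj.continuous

theorem exists_int_of_circleProj_eq {F G : ℝ → ℝ} (hF : Continuous F) (hG : Continuous G)
    (h : ∀ x, circleProj (F x) = circleProj (G x)) : ∃ k : ℤ, ∀ x, F x = G x + k := by
  choose k hk using fun x ↦ circleProj_eq_iff.mp (h x)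
  have hk_cont : Continuous fun x ↦ (k x : ℝ) :=
    (hF.sub hG).congr fun x ↦ sub_eq_of_eq_add' (hk x)
  have hconst (x : ℝ) : k x = k 0 :=
    PreconnectedSpace.constant inferInstance
      (Int.isClosedEmbedding_coe_real.isEmbedding.continuous_iff.mpr hk_cont)
  exact ⟨k 0, fun x ↦ hconst x ▸ hk x⟩

/-- The map of the circle induced by a lift `F`, read off an arbitrary preimage. -/
noncomputable def circleSelfMap (F : CircleDeg1Lift) (z : Circle) : Circle :=
  circleProj (F (surjInv circleProj_surjective z))

theorem circleSelfMap_circleProj (F : CircleDeg1Lift) (x : ℝ) :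
    circleSelfMap F (circleProj x) = circleProj (F x) := by
  obtain ⟨k, hk⟩ := circleProj_eq_iff.mp (surjInv_eq circleProj_surjective (circleProj x))
  rw [circleSelfMap, hk, F.map_add_int]
  exact circleProj_eq_iff.mpr ⟨k, rfl⟩

theorem circleSelfMap_mul (F G : CircleDeg1Lift) (z : Circle) :
    circleSelfMap (F * G) z = circleSelfMap F (circleSelfMap G z) := by
  obtain ⟨x, rfl⟩ := circleProj_surjective z
  rw [circleSelfMap_circleProj, circleSelfMap_circleProj, circleSelfMap_circleProj,
    CircleDeg1Lift.mul_apply]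

theorem circleSelfMap_one (z : Circle) : circleSelfMap 1 z = z := surjInv_eq circleProj_surjective z

theorem continuous_circleSelfMap {F : CircleDeg1Lift} (hF : Continuous F) :
    Continuous (circleSelfMap F) := by
  rw [(isCoveringMap_circleProj.isQuotientMap circleProj_surjective).continuous_iff]
  exact (continuous_circleProj.comp hF).congr fun x ↦ (circleSelfMap_circleProj F x).symm

/-- The homomorphism from the lifts of orientation preserving homeomorphisms of the circle to the
homeomorphisms of the circle. -/
noncomputable def circleHomeo : CircleDeg1Liftˣ →* (Circle ≃ₜ Circle) where
  toFun F :=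
    { toFun := circleSelfMap F
      invFun := circleSelfMap ↑F⁻¹
      left_inv z := by rw [← circleSelfMap_mul, F.inv_mul, circleSelfMap_one]
      right_inv z := by rw [← circleSelfMap_mul, F.mul_inv, circleSelfMap_one]
      continuous_toFun := continuous_circleSelfMap (CircleDeg1Lift.toOrderIso F).continuous
      continuous_invFun := continuous_circleSelfMap (CircleDeg1Lift.toOrderIso F⁻¹).continuous }
  map_one' := Homeomorph.ext circleSelfMap_one
  map_mul' F G := Homeomorph.ext (circleSelfMap_mul F G)

theorem circleHomeo_circleProj (F : CircleDeg1Liftˣ) (x : ℝ) :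
    circleHomeo F (circleProj x) = circleProj (F x) := circleSelfMap_circleProj F x

theorem exists_int_of_circleHomeo_eq_one {z : CircleDeg1Liftˣ} (hz : circleHomeo z = 1) :
    ∃ k : ℤ, z = CircleDeg1Lift.translate (Multiplicative.ofAdd (k : ℝ)) := by
  obtain ⟨k, hk⟩ := exists_int_of_circleProj_eq (CircleDeg1Lift.toOrderIso z).continuous
    continuous_id fun x ↦ (circleHomeo_circleProj z x).symm.trans
      (DFunLike.congr_fun hz (circleProj x))
  refine ⟨k, Units.ext (CircleDeg1Lift.ext fun x ↦ ?_)⟩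
  rw [CircleDeg1Lift.translate_apply, add_comm]
  exact hk x

theorem commute_of_circleHomeo_eq_one {z : CircleDeg1Liftˣ} (hz : circleHomeo z = 1)
    (u : CircleDeg1Liftˣ) : Commute z u := by
  obtain ⟨k, rfl⟩ := exists_int_of_circleHomeo_eq_one hz
  refine Units.ext (CircleDeg1Lift.ext fun x ↦ ?_)
  simp only [Units.val_mul, CircleDeg1Lift.mul_apply, CircleDeg1Lift.translate_apply,
    CircleDeg1Lift.map_int_add]

/- The commutator of `x` and `y` is a translation by an integer, equal to the difference of the
translation numbers of the conjugate elements `x * y * x⁻¹` and `y`. -/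
theorem commute_of_commute_circleHomeo {x y : CircleDeg1Liftˣ}
    (h : Commute (circleHomeo x) (circleHomeo y)) : Commute x y := by
  have hz : circleHomeo (x * y * x⁻¹ * y⁻¹) = 1 := by
    rw [map_mul, map_mul, map_mul, map_inv, map_inv, h.eq, mul_inv_cancel_right, mul_inv_cancel]
  obtain ⟨k, hk⟩ := exists_int_of_circleHomeo_eq_one hz
  have hconj : x * y * x⁻¹ = CircleDeg1Lift.translate (Multiplicative.ofAdd (k : ℝ)) * y := by
    rw [← hk, inv_mul_cancel_right]
  have hτ := congrArg (fun u : CircleDeg1Liftˣ ↦ CircleDeg1Lift.translationNumber u) hconj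
  have hcomm := (commute_of_circleHomeo_eq_one (hk ▸ hz) y).units_val
  simp only [Units.val_mul] at hτ
  rw [CircleDeg1Lift.translationNumber_conj_eq,
    CircleDeg1Lift.translationNumber_mul_of_commute hcomm,
    CircleDeg1Lift.translationNumber_translate, right_eq_add, Int.cast_eq_zero] at hτ
  rwa [hτ, Int.cast_zero, ofAdd_zero, map_one, one_mul, mul_inv_eq_iff_eq_mul] at hconj

theorem exists_continuous_lift (f : Circle ≃ₜ Circle) :
    ∃ F : C(ℝ, ℝ), ∀ x, f (circleProj x) = circleProj (F x) := by
  obtain ⟨e, he⟩ := circleProj_surjective (f (circleProj 0))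
  obtain ⟨F, ⟨-, hF⟩, -⟩ := isCoveringMap_circleProj.existsUnique_continuousMap_lifts
    ⟨f ∘ circleProj, f.continuous.comp continuous_circleProj⟩ 0 e he
  exact ⟨F, fun x ↦ (congrFun hF x).symm⟩

theorem exists_int_lift_add_int {f : Circle → Circle} {F : C(ℝ, ℝ)}
    (hF : ∀ x, f (circleProj x) = circleProj (F x)) :
    ∃ m : ℤ, ∀ x (k : ℤ), F (x + k) = F x + k * m := by
  obtain ⟨m, hm⟩ : ∃ m : ℤ, ∀ x, F (x + 1) = F x + m :=
    exists_int_of_circleProj_eq (by fun_prop) (by fun_prop) fun x ↦ by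
      rw [← hF, ← hF, circleProj_eq_iff.mpr ⟨1, by rw [Int.cast_one]⟩]
  let F' : AddConstMap ℝ ℝ 1 m := ⟨F, hm⟩
  exact ⟨m, fun x k ↦ (AddConstMapClass.map_add_int' F' x k).trans (by rw [zsmul_eq_mul]; rfl)⟩

/- A homeomorphism of the circle has degree `1` or `-1`, so its square has degree `1`. -/
theorem exists_circleHomeo_eq_sq (f : Circle ≃ₜ Circle) :
    ∃ F : CircleDeg1Liftˣ, circleHomeo F = f ^ 2 := by
  obtain ⟨F, hF⟩ := exists_continuous_lift f
  obtain ⟨G, hG⟩ := exists_continuous_lift f⁻¹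
  obtain ⟨k, hGF⟩ := exists_int_of_circleProj_eq (G.comp F).continuous continuous_id fun x ↦ by
    rw [ContinuousMap.comp_apply, ← hG, ← hF]; exact f.symm_apply_apply _
  obtain ⟨m, hm⟩ := exists_int_lift_add_int hF
  obtain ⟨n, hn⟩ := exists_int_lift_add_int hG
  have hmn : (m : ℝ) * n = 1 := by
    have h0 := hGF 0
    have h1 := hGF (0 + (1 : ℤ))
    rw [ContinuousMap.comp_apply, hm, Int.cast_one, one_mul, hn, ← ContinuousMap.comp_apply, h0,
      id, id] at h1
    linarith
  have hdeg : (m : ℝ) * m = 1 := by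
    exact_mod_cast Int.isUnit_mul_self (IsUnit.of_mul_eq_one n (by exact_mod_cast hmn))
  have hinj : Injective F := fun x y hxy ↦ by
    have hx := hGF x
    have hy := hGF y
    simp only [ContinuousMap.comp_apply, hxy] at hx hy
    exact add_right_cancel (hx.symm.trans hy)
  have hmono : StrictMono (F ∘ F) :=
    (F.continuous.strictMono_of_inj hinj).elim (fun h ↦ h.comp h) fun h ↦ h.comp h
  let F₂ : CircleDeg1Lift :=
    ⟨⟨F ∘ F, hmono.monotone⟩, fun x ↦ by
      have h := hm x 1
      rw [Int.cast_one, one_mul] at h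
      exact (congrArg F h).trans ((hm (F x) m).trans (by rw [hdeg]; rfl))⟩
  have hsurj : Surjective F₂ := F₂.continuous_iff_surjective.mp (F.comp F).continuous
  obtain ⟨u, hu⟩ := CircleDeg1Lift.isUnit_iff_bijective.mpr ⟨hmono.injective, hsurj⟩
  refine ⟨u, Homeomorph.ext fun z ↦ ?_⟩
  obtain ⟨x, rfl⟩ := circleProj_surjective z
  rw [circleHomeo_circleProj, hu, sq, Homeomorph.mul_apply, hF, hF]
  rfl

end CircleHomeo

section CircleAction

open Set Function

theorem hasFixedPointsInGaps_towerConj {X : Type*} [ConditionallyCompleteLinearOrder X]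
    [TopologicalSpace X] [OrderTopology X] [DenselyOrdered X] {s a d c : X ≃o X}
    (ha : MapsTo a (fixedPoints s) (fixedPoints s)) (hd : MapsTo d (fixedPoints s) (fixedPoints s))
    (hc : SemiconjBy s c c⁻¹) (i : Fin 2 × Fin 3) :
    HasFixedPointsInGaps s (towerConj a d c i) := by
  have hpow {f : X ≃o X} (hf : MapsTo f (fixedPoints s) (fixedPoints s)) (n : ℕ) :
      MapsTo (f ^ n) (fixedPoints s) (fixedPoints s) :=
    hom_coe_pow (fun f : X ≃o X ↦ ⇑f) rfl (fun _ _ ↦ rfl) f n ▸ hf.iterate n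
  exact .of_semiconjBy_inv hc ((hpow hd _).comp (hpow ha _))

theorem exists_lift_semiconjBy_inv {s c : CircleDeg1Liftˣ}
    (h : SemiconjBy (circleHomeo s) (circleHomeo c) (circleHomeo c)⁻¹) :
    ∃ z, circleHomeo z = 1 ∧ ∀ s', circleHomeo s' = circleHomeo s → SemiconjBy s' c (z * c⁻¹) := by
  refine ⟨s * c * s⁻¹ * c, ?_, fun s' hs' ↦ ?_⟩
  · rw [map_mul, map_mul, map_mul, map_inv, h.eq, mul_inv_cancel_right, inv_mul_cancel]
  · have hs : circleHomeo (s' * s⁻¹) = 1 := by rw [map_mul, map_inv, hs', mul_inv_cancel]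
    rw [mul_inv_cancel_right, ← inv_mul_cancel_right s' s]
    exact SemiconjBy.mul_left (commute_of_circleHomeo_eq_one hs _) (SemiconjBy.conj_mk s c)

theorem hasFixedPointsInGaps_towerConj_inv_mul_sq {s a c d z z' : CircleDeg1Liftˣ}
    (hz : circleHomeo z = 1) (hz' : circleHomeo z' = 1) (ha : Commute a s)
    (hc : SemiconjBy s c (z * c⁻¹)) (hd : SemiconjBy s d (z' * d⁻¹)) (i : Fin 2 × Fin 3) :
    HasFixedPointsInGaps (CircleDeg1Lift.toOrderIso s)
      (CircleDeg1Lift.toOrderIso (towerConj a d (z⁻¹ * c ^ 2) i)) := by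
  let T := CircleDeg1Lift.toOrderIso
  have hc₂ : SemiconjBy (T s) (T (z⁻¹ * c ^ 2)) (T (z⁻¹ * c ^ 2))⁻¹ := map_inv T _ ▸
    (semiconjBy_inv_mul_sq (commute_of_circleHomeo_eq_one hz s)
      (commute_of_circleHomeo_eq_one hz c) hc).map T
  have hTd : SemiconjBy (T s) (T d) (T z' * (T d)⁻¹) := by
    simpa only [map_mul, map_inv] using hd.map T
  rw [map_towerConj]
  refine hasFixedPointsInGaps_towerConj (fun p hp ↦ ?_) (fun p hp ↦ ?_) hc₂ i
  · exact IsFixedPt.map hp (DFunLike.congr_fun (ha.map T).eq)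
  · exact isFixedPt_apply_of_semiconjBy_mul_inv ((commute_of_circleHomeo_eq_one hz' s).map T)
      ((commute_of_circleHomeo_eq_one hz' d).map T) hTd hp

/- Every lift `s` of `a ^ 6` inverts a lift `z⁻¹ * c ^ 2` of `c ^ 2`, while `a` and `d` preserve
the fixed points of `s`; so the six conjugates of this lift have fixed points in the gaps of `s`. -/
theorem KleinSystem.exists_hasFixedPointsInGaps {a b c d : CircleDeg1Liftˣ}
    (h : KleinSystem (circleHomeo a) (circleHomeo b) (circleHomeo c) (circleHomeo d)) :
    ∃ w, circleHomeo w = circleHomeo b ^ 6 ∧ ∀ s, circleHomeo s = circleHomeo a ^ 6 →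
      HasFixedPointsInGaps (CircleDeg1Lift.toOrderIso s) (CircleDeg1Lift.toOrderIso w) := by
  obtain ⟨z, hz, hc⟩ := exists_lift_semiconjBy_inv (map_pow circleHomeo a 6 ▸ h.semiconjBy_inv)
  obtain ⟨z', hz', hd⟩ := exists_lift_semiconjBy_inv (map_pow circleHomeo a 6 ▸ h.semiconjBy_inv')
  have hc₂ : circleHomeo (z⁻¹ * c ^ 2) = circleHomeo c ^ 2 := by
    rw [map_mul, map_inv, hz, inv_one, one_mul, map_pow]
  have hcomm (i j) :
      Commute (towerConj a d (z⁻¹ * c ^ 2) i) (towerConj a d (z⁻¹ * c ^ 2) j) := by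
    apply commute_of_commute_circleHomeo
    rw [map_towerConj, map_towerConj, hc₂]
    exact h.commute i j
  obtain ⟨w, hw, hwb⟩ : circleHomeo b ^ 6 ∈
      (Subgroup.closure (range (towerConj a d (z⁻¹ * c ^ 2)))).map circleHomeo := by
    rw [map_closure_range_towerConj, hc₂]
    exact h.mem_closure
  refine ⟨w, hwb, fun s hs ↦ ?_⟩
  rw [← map_pow] at hs
  have hzs : circleHomeo (s * (a ^ 6)⁻¹) = 1 := by rw [map_mul, map_inv, hs, mul_inv_cancel]
  have ha : Commute a s := by
    rw [← inv_mul_cancel_right s (a ^ 6)]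
    exact (commute_of_circleHomeo_eq_one hzs a).symm.mul_right (Commute.self_pow a 6)
  refine .of_mem_closure (fun i j ↦ (hcomm i j).map CircleDeg1Lift.toOrderIso)
    (hasFixedPointsInGaps_towerConj_inv_mul_sq hz hz' ha (hc s hs) (hd s hs)) ?_
  rw [range_comp', ← MonoidHom.map_closure]
  exact Subgroup.mem_map_of_mem _ hw

theorem pow_six_eq_one_of_kleinSystem {a b c d c' d' : CircleDeg1Liftˣ}
    (h : KleinSystem (circleHomeo a) (circleHomeo b) (circleHomeo c) (circleHomeo d))
    (h' : KleinSystem (circleHomeo b) (circleHomeo a) (circleHomeo c') (circleHomeo d')) :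
    circleHomeo a ^ 6 = 1 := by
  obtain ⟨w, hw, hwa⟩ := h.exists_hasFixedPointsInGaps
  obtain ⟨s, hs, hsb⟩ := h'.exists_hasFixedPointsInGaps
  have hs_one : CircleDeg1Lift.toOrderIso s = 1 := (hwa s hs).eq_one (hsb w hw)
  have hs_one' : s = 1 := Units.ext (CircleDeg1Lift.ext fun x ↦ DFunLike.congr_fun hs_one x)
  rw [← hs, hs_one', map_one]

end CircleAction

section Plane

theorem plane_ext {v w : Plane} (h0 : v 0 = w 0) (h1 : v 1 = w 1) : v = w :=
  PiLp.ext (Fin.forall_fin_two.mpr ⟨h0, h1⟩)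

theorem continuous_plane_mk {X : Type*} [TopologicalSpace X] {f g : X → ℝ} (hf : Continuous f)
    (hg : Continuous g) : Continuous fun x ↦ (!₂[f x, g x] : Plane) :=
  (PiLp.continuous_toLp 2 _).comp (hf.finCons (hg.finCons continuous_const))

/-- The action `(x, y) ↦ (φ x, y)` of the homeomorphisms of the line on the plane. -/
noncomputable def horizontalMap : (ℝ ≃ₜ ℝ) →* (Plane ≃ₜ Plane) where
  toFun φ :=
    { toFun w := !₂[φ (w 0), w 1]
      invFun w := !₂[φ.symm (w 0), w 1]
      left_inv w := plane_ext (φ.symm_apply_apply _) rfl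
      right_inv w := plane_ext (φ.apply_symm_apply _) rfl
      continuous_toFun := continuous_plane_mk (by fun_prop) (by fun_prop)
      continuous_invFun := continuous_plane_mk (by fun_prop) (by fun_prop) }
  map_one' := Homeomorph.ext fun _ ↦ plane_ext rfl rfl
  map_mul' _ _ := Homeomorph.ext fun _ ↦ plane_ext rfl rfl

/-- The action `(x, y) ↦ (x, y + f x)` of the additive group of continuous functions on the
plane. -/
noncomputable def verticalShear : Multiplicative C(ℝ, ℝ) →* (Plane ≃ₜ Plane) where
  toFun f :=
    { toFun w := !₂[w 0, w 1 + f.toAdd (w 0)]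
      invFun w := !₂[w 0, w 1 - f.toAdd (w 0)]
      left_inv w := plane_ext rfl (add_sub_cancel_right _ _)
      right_inv w := plane_ext rfl (sub_add_cancel _ _)
      continuous_toFun := continuous_plane_mk (by fun_prop) (by fun_prop)
      continuous_invFun := continuous_plane_mk (by fun_prop) (by fun_prop) }
  map_one' := Homeomorph.ext fun w ↦ plane_ext rfl (add_zero (w 1))
  map_mul' f g := Homeomorph.ext fun w ↦ plane_ext rfl <| by
    change w 1 + (f.toAdd (w 0) + g.toAdd (w 0)) = w 1 + g.toAdd (w 0) + f.toAdd (w 0)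
    ring

theorem semiconjBy_verticalShear (φ : ℝ ≃ₜ ℝ) (f : C(ℝ, ℝ)) :
    SemiconjBy (horizontalMap φ) (verticalShear (.ofAdd (f.comp φ))) (verticalShear (.ofAdd f)) :=
  Homeomorph.ext fun _ ↦ plane_ext rfl rfl

theorem towerConj_verticalShear (α φ : ℝ ≃ₜ ℝ) (f : C(ℝ, ℝ)) (i : Fin 2 × Fin 3) :
    towerConj (horizontalMap α) (horizontalMap φ) (verticalShear (.ofAdd f)) i =
      verticalShear (.ofAdd (f.comp (φ ^ (i.1 : ℕ) * α ^ (4 * (i.2 : ℕ)) : ℝ ≃ₜ ℝ))) := by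
  rw [towerConj, ← map_pow, ← map_pow, ← map_mul, mul_assoc, inv_mul_eq_iff_eq_mul]
  exact (semiconjBy_verticalShear _ f).eq.symm

theorem addRight_pow (t : ℝ) (n : ℕ) : Homeomorph.addRight t ^ n = Homeomorph.addRight (n * t) := by
  induction n with
  | zero => exact Homeomorph.ext fun x ↦ by simp
  | succ n ih =>
    refine Homeomorph.ext fun x ↦ ?_
    rw [pow_succ, ih, Homeomorph.mul_apply]
    simp only [Homeomorph.coe_addRight]
    push_cast
    ring

theorem translateX_eq (t : ℝ) : translateX t = horizontalMap (Homeomorph.addRight t) :=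
  Homeomorph.ext fun _ ↦ plane_ext rfl rfl

theorem deltaMap_eq : deltaMap = horizontalMap delta0 :=
  Homeomorph.ext fun _ ↦ plane_ext rfl rfl

theorem translateY_eq (t : ℝ) : translateY t = verticalShear (.ofAdd (.const ℝ t)) :=
  Homeomorph.ext fun _ ↦ plane_ext rfl rfl

/-- The function `gamma0` as a continuous map. -/
noncomputable def gamma0Map : C(ℝ, ℝ) := ⟨gamma0, continuous_gamma0⟩

theorem shear_eq (t : ℝ) : shear t = verticalShear (.ofAdd (t • gamma0Map)) :=
  Homeomorph.ext fun _ ↦ plane_ext rfl rfl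

end Plane

section PlanarRelations

theorem gamma0_add_one (x : ℝ) : gamma0 (x + 1) = gamma0 x := by
  rw [gamma0, gamma0, Int.fract_add_one]

theorem gamma0_of_mem {x : ℝ} (h0 : 0 ≤ x) (h1 : x < 1) : gamma0 x = gamma0Period x := by
  rw [gamma0, Int.fract_eq_self.mpr ⟨h0, h1⟩]

theorem delta0_add_one (x : ℝ) : delta0 (x + 1) = delta0 x + 1 := by
  change (⌊x + 1⌋ : ℝ) + delta0Period (Int.fract (x + 1)) =
    ⌊x⌋ + delta0Period (Int.fract x) + 1
  rw [Int.fract_add_one, Int.floor_add_one]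
  push_cast
  ring

theorem delta0_of_mem {x : ℝ} (h0 : 0 ≤ x) (h1 : x < 1) : delta0 x = delta0Period x := by
  change (⌊x⌋ : ℝ) + delta0Period (Int.fract x) = delta0Period x
  rw [Int.fract_eq_self.mpr ⟨h0, h1⟩, Int.floor_eq_zero_iff.mpr ⟨h0, h1⟩, Int.cast_zero, zero_add]

theorem gamma0_add_half (x : ℝ) : gamma0 (x + 1 / 2) = -gamma0 x := by
  have hperiodic : Function.Periodic (fun x ↦ gamma0 (x + 1 / 2) + gamma0 x) (1 / 2) := fun x ↦ by
    simp only [add_assoc, add_halves]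
    rw [gamma0_add_one, add_comm]
  obtain ⟨y, ⟨h0, h1⟩, hy⟩ := hperiodic.exists_mem_Ico₀ one_half_pos x
  refine eq_neg_of_add_eq_zero_left (hy.trans ?_)
  rw [gamma0_of_mem (by linarith) (by linarith), gamma0_of_mem h0 (by linarith), gamma0Period,
    gamma0Period, if_neg (by linarith), if_pos h1]
  ring

/-- The function `γ₀ ∘ δ₀ - 2 γ₀`. Its translates by `0`, `1 / 3` and `2 / 3` add up to a constant,
which exhibits a vertical translation as a product of conjugates of `shear`. -/
noncomputable def gammaDefect (x : ℝ) : ℝ := gamma0 (delta0 x) - 2 * gamma0 x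

theorem gammaDefect_add_one (x : ℝ) : gammaDefect (x + 1) = gammaDefect x := by
  rw [gammaDefect, delta0_add_one, gamma0_add_one, gamma0_add_one, gammaDefect]

theorem gammaDefect_of_mem {x : ℝ} (h0 : 0 ≤ x) (h1 : x < 1) :
    gammaDefect x = if x < 1 / 3 then -1 + 6 * x else if x < 2 / 3 then 1 else 5 - 6 * x := by
  have hδ : 0 ≤ delta0Period x ∧ delta0Period x < 1 := by
    unfold delta0Period
    split_ifs <;> constructor <;> linarith
  rw [gammaDefect, delta0_of_mem h0 h1, gamma0_of_mem h0 h1, gamma0_of_mem hδ.1 hδ.2]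
  unfold gamma0Period delta0Period
  split_ifs <;> linarith

theorem sum_gammaDefect (x : ℝ) :
    gammaDefect x + gammaDefect (x + 1 / 3) + gammaDefect (x + 2 / 3) = 1 := by
  have hperiodic : Function.Periodic
      (fun x ↦ gammaDefect x + gammaDefect (x + 1 / 3) + gammaDefect (x + 2 / 3)) (1 / 3) := by
    intro x
    have h1 : x + 1 / 3 + 1 / 3 = x + 2 / 3 := by ring
    have h2 : x + 1 / 3 + 2 / 3 = x + 1 := by ring
    simp only [h1, h2, gammaDefect_add_one]
    ring
  obtain ⟨y, ⟨h0, h1⟩, hy⟩ := hperiodic.exists_mem_Ico₀ (by norm_num) x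
  refine hy.trans ?_
  rw [gammaDefect_of_mem h0 (by linarith), gammaDefect_of_mem (by linarith) (by linarith),
    gammaDefect_of_mem (by linarith) (by linarith)]
  split_ifs <;> linarith

theorem semiconjBy_addRight_delta0 :
    SemiconjBy (Homeomorph.addRight (1 / 2 : ℝ)) delta0 delta0⁻¹ :=
  SemiconjBy.inv_right_iff.mp <| Homeomorph.ext fun x ↦ (delta0_add_half x).symm

/-- The function whose vertical shear is the conjugate `towerConj α δ (γ ^ 2) i`, see
`towerConj_shear`. -/
noncomputable def towerShear (i : Fin 2 × Fin 3) : C(ℝ, ℝ) :=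
  ((1 / 84 : ℝ) • gamma0Map).comp
    (delta0 ^ (i.1 : ℕ) * Homeomorph.addRight (1 / 12) ^ (4 * (i.2 : ℕ)) : ℝ ≃ₜ ℝ)

theorem towerConj_shear (i : Fin 2 × Fin 3) :
    towerConj (translateX (1 / 12)) deltaMap (shear (1 / 168) ^ 2) i =
      verticalShear (.ofAdd (towerShear i)) := by
  have hsq : (2 : ℕ) • (1 / 168 : ℝ) • gamma0Map = (1 / 84 : ℝ) • gamma0Map := by
    rw [← Nat.cast_smul_eq_nsmul ℝ, smul_smul]
    norm_num
  rw [translateX_eq, deltaMap_eq, shear_eq, ← map_pow, ← ofAdd_nsmul, hsq,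
    towerConj_verticalShear, towerShear]

theorem towerShear_apply (i : Fin 2 × Fin 3) (x : ℝ) :
    towerShear i x = 1 / 84 * gamma0 ((delta0 ^ (i.1 : ℕ)) (x + (i.2 : ℕ) / 3)) := by
  have hshift : x + (4 * (i.2 : ℕ) : ℕ) * (1 / 12 : ℝ) = x + (i.2 : ℕ) / 3 := by
    push_cast
    ring
  rw [← hshift, towerShear, addRight_pow]
  rfl

theorem sum_towerShear :
    ∑ j : Fin 3, ((42 : ℕ) • towerShear (1, j) - (84 : ℕ) • towerShear (0, j)) =
      .const ℝ (1 / 2) := by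
  ext x
  have hterm (j : Fin 3) : ((42 : ℕ) • towerShear (1, j) - (84 : ℕ) • towerShear (0, j)) x =
      gammaDefect (x + (j : ℕ) / 3) / 2 := by
    have h0 : towerShear (0, j) x = 1 / 84 * gamma0 (x + (j : ℕ) / 3) := towerShear_apply (0, j) x
    have h1 : towerShear (1, j) x = 1 / 84 * gamma0 (delta0 (x + (j : ℕ) / 3)) :=
      towerShear_apply (1, j) x
    change (42 : ℕ) • towerShear (1, j) x - (84 : ℕ) • towerShear (0, j) x = _
    rw [h0, h1, gammaDefect, nsmul_eq_mul, nsmul_eq_mul]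
    push_cast
    ring
  rw [ContinuousMap.sum_apply, Finset.sum_congr rfl fun j _ ↦ hterm j, ← Finset.sum_div,
    Fin.sum_univ_three, ContinuousMap.const_apply, ← sum_gammaDefect x]
  norm_num

theorem translateY_pow_six_mem_closure :
    translateY (1 / 12) ^ 6 ∈ Subgroup.closure
      (Set.range (towerConj (translateX (1 / 12)) deltaMap (shear (1 / 168) ^ 2))) := by
  set S := Subgroup.closure
    (Set.range (towerConj (translateX (1 / 12)) deltaMap (shear (1 / 168) ^ 2)))
  let T : AddSubgroup C(ℝ, ℝ) := Subgroup.toAddSubgroup' (S.comap verticalShear)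
  have hT (i) : towerShear i ∈ T := Subgroup.subset_closure ⟨i, towerConj_shear i⟩
  have hconst : ContinuousMap.const ℝ (1 / 2 : ℝ) ∈ T := by
    rw [← sum_towerShear]
    exact sum_mem fun j _ ↦ sub_mem (nsmul_mem (hT (1, j)) 42) (nsmul_mem (hT (0, j)) 84)
  have hpow : (6 : ℕ) • ContinuousMap.const ℝ (1 / 12 : ℝ) = .const ℝ (1 / 2) :=
    ContinuousMap.ext fun _ ↦ (nsmul_eq_mul _ _).trans (by norm_num)
  rw [translateY_eq, ← map_pow, ← ofAdd_nsmul, hpow]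
  exact hconst

theorem translateX_pow (t : ℝ) (n : ℕ) : translateX t ^ n = translateX (n * t) := by
  rw [translateX_eq, translateX_eq, ← map_pow, addRight_pow]

theorem kleinSystem_translateX :
    KleinSystem (translateX (1 / 12)) (translateY (1 / 12)) (shear (1 / 168)) deltaMap := by
  have hα : translateX (1 / 12) ^ 6 = horizontalMap (Homeomorph.addRight (1 / 2)) := by
    rw [translateX_pow, translateX_eq]
    norm_num
  refine ⟨?_, ?_, fun i j ↦ ?_, translateY_pow_six_mem_closure⟩
  · have hγ : gamma0Map.comp (Homeomorph.addRight (1 / 2 : ℝ)) = -gamma0Map :=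
      ContinuousMap.ext gamma0_add_half
    rw [hα, shear_eq, ← SemiconjBy.inv_right_iff, inv_inv, ← map_inv, ← ofAdd_neg, ← smul_neg, ← hγ]
    exact semiconjBy_verticalShear _ ((1 / 168 : ℝ) • gamma0Map)
  · rw [hα, deltaMap_eq, ← map_inv]
    exact semiconjBy_addRight_delta0.map horizontalMap
  · rw [towerConj_shear, towerConj_shear]
    exact (Commute.all _ _).map verticalShear

end PlanarRelations

section SquareRoot

variable (f : ℝ ≃o ℝ)

/-- The equivalence relation on the line whose classes are the fixed points of `f` and the maximal
intervals without fixed points: each of two equivalent points lies between two points of the orbit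
of the other. -/
def orbitHullSetoid : Setoid ℝ where
  r x y := ∃ m n : ℤ, (f ^ m) x ≤ y ∧ y ≤ (f ^ n) x
  iseqv :=
    { refl x := ⟨0, 0, le_rfl, le_rfl⟩
      symm := by
        rintro x y ⟨m, n, hm, hn⟩
        refine ⟨-n, -m, ?_, ?_⟩
        · simpa only [zpow_neg, RelIso.inv_apply_self] using (f ^ (-n)).monotone hn
        · simpa only [zpow_neg, RelIso.inv_apply_self] using (f ^ (-m)).monotone hm
      trans := by
        rintro x y z ⟨m, n, hm, hn⟩ ⟨m', n', hm', hn'⟩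
        refine ⟨m' + m, n' + n, ?_, ?_⟩ <;> rw [zpow_add, RelIso.mul_apply]
        exacts [((f ^ m').monotone hm).trans hm', hn'.trans ((f ^ n').monotone hn)] }

variable {f}

theorem orbitHullSetoid_inv {x y : ℝ} : orbitHullSetoid f⁻¹ x y ↔ orbitHullSetoid f x y := by
  constructor <;> rintro ⟨m, n, h⟩ <;>
    exact ⟨-m, -n, by simpa only [inv_zpow', neg_neg] using h⟩

theorem orbitHullSetoid_of_mem_Icc {x y z : ℝ} (h : orbitHullSetoid f x y) (hz : z ∈ Set.Icc x y) :
    orbitHullSetoid f x z :=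
  let ⟨_, n, _, hn⟩ := h
  ⟨0, n, hz.1, hz.2.trans hn⟩

theorem lt_of_lt_of_not_orbitHullSetoid {x y z w : ℝ} (hxy : x < y)
    (hne : ¬ orbitHullSetoid f x y) (hxz : orbitHullSetoid f x z) (hyw : orbitHullSetoid f y w) :
    z < w := by
  by_contra! hwz
  rcases le_total y z with hyz | hzy
  · exact hne (orbitHullSetoid_of_mem_Icc hxz ⟨hxy.le, hyz⟩)
  · have hwz' := orbitHullSetoid_of_mem_Icc ((orbitHullSetoid f).symm hyw) ⟨hwz, hzy⟩
    exact hne (Setoid.trans' _ hxz (Setoid.symm' _ (Setoid.trans' _ hyw hwz')))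

/-- An orbit of `f` interpolated to real times, filling the equivalence class of `p` for
`orbitHullSetoid f`. -/
structure IsOrbitCurve (f : ℝ ≃o ℝ) (p : ℝ) (e : ℝ → ℝ) : Prop where
  map_add_one : ∀ t, e (t + 1) = f (e t)
  range_eq : Set.range e = {y | orbitHullSetoid f p y}
  monotonicity : StrictMono e ∨ StrictAnti e ∨ ∀ s t, e s = e t

theorem IsOrbitCurve.apply_add_lt {p : ℝ} {e : ℝ → ℝ} (he : IsOrbitCurve f p e) {s t : ℝ}
    (h : e s < e t) (u : ℝ) : e (s + u) < e (t + u) := by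
  rcases he.monotonicity with hmono | hanti | hconst
  · exact hmono (add_lt_add_left (hmono.lt_iff_lt.mp h) u)
  · exact hanti (add_lt_add_left (hanti.lt_iff_gt.mp h) u)
  · exact absurd (hconst s t) h.ne

theorem IsOrbitCurve.apply_add_eq {p : ℝ} {e : ℝ → ℝ} (he : IsOrbitCurve f p e) {s t : ℝ}
    (h : e s = e t) (u : ℝ) : e (s + u) = e (t + u) := by
  rcases he.monotonicity with hmono | hanti | hconst
  · rw [hmono.injective h]
  · rw [hanti.injective h]
  · exact hconst _ _

/-- The orbit of `p` under `f`, interpolated affinely between consecutive points. -/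
noncomputable def orbitCurve (f : ℝ ≃o ℝ) (p t : ℝ) : ℝ :=
  (f ^ ⌊t⌋) (AffineMap.lineMap p (f p) (Int.fract t))

theorem orbitCurve_add_one (p t : ℝ) : orbitCurve f p (t + 1) = f (orbitCurve f p t) := by
  rw [orbitCurve, Int.fract_add_one, Int.floor_add_one, add_comm, zpow_one_add]
  rfl

theorem strictMono_zpow_apply {p : ℝ} (hp : p < f p) : StrictMono fun n : ℤ ↦ (f ^ n) p :=
  strictMono_int_of_lt_succ fun n ↦ by
    rw [zpow_add_one]
    exact (f ^ n).strictMono hp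

theorem orbitCurve_mem_Ico {p : ℝ} (hp : p < f p) (t : ℝ) :
    orbitCurve f p t ∈ Set.Ico ((f ^ ⌊t⌋) p) ((f ^ (⌊t⌋ + 1)) p) := by
  rw [zpow_add_one]
  constructor
  · exact (f ^ ⌊t⌋).monotone ((left_le_lineMap_iff_nonneg hp).mpr (Int.fract_nonneg t))
  · exact (f ^ ⌊t⌋).strictMono ((lineMap_lt_right_iff_lt_one hp).mpr (Int.fract_lt_one t))

theorem strictMono_orbitCurve {p : ℝ} (hp : p < f p) : StrictMono (orbitCurve f p) := by
  intro s t hst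
  rcases (Int.floor_mono hst.le).eq_or_lt with heq | hlt
  · have hfract : Int.fract s < Int.fract t := by
      rw [Int.fract, Int.fract, heq]
      exact sub_lt_sub_right hst _
    rw [orbitCurve, orbitCurve, heq]
    exact (f ^ ⌊t⌋).strictMono ((lineMap_lt_lineMap_iff_of_lt' hp).mpr hfract)
  · calc orbitCurve f p s < (f ^ (⌊s⌋ + 1)) p := (orbitCurve_mem_Ico hp s).2
      _ ≤ (f ^ ⌊t⌋) p := (strictMono_zpow_apply hp).monotone (Int.add_one_le_iff.mpr hlt)
      _ ≤ orbitCurve f p t := (orbitCurve_mem_Ico hp t).1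

theorem range_orbitCurve {p : ℝ} (hp : p < f p) :
    Set.range (orbitCurve f p) = {y | orbitHullSetoid f p y} := by
  refine Set.Subset.antisymm ?_ fun y ⟨m, n, hm, hn⟩ ↦ ?_
  · rintro _ ⟨t, rfl⟩
    exact ⟨⌊t⌋, ⌊t⌋ + 1, (orbitCurve_mem_Ico hp t).1, (orbitCurve_mem_Ico hp t).2.le⟩
  have hmono := strictMono_zpow_apply hp
  obtain ⟨k, hk, hmax⟩ := Int.exists_greatest_of_bdd (P := fun k ↦ (f ^ k) p ≤ y)
    ⟨n, fun k hk ↦ hmono.le_iff_le.mp (hk.trans hn)⟩ ⟨m, hm⟩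
  have hk' : y < (f ^ (k + 1)) p := lt_of_not_ge fun h ↦ (lt_add_one k).not_ge (hmax _ h)
  set z := (f ^ k)⁻¹ y with hz
  have hy : (f ^ k) z = y := RelIso.apply_inv_self _ _
  have hpz : p ≤ z := (f ^ k).le_iff_le.mp (hk.trans_eq hy.symm)
  have hzp : z < f p := (f ^ k).lt_iff_lt.mp (hy.trans_lt (by rwa [zpow_add_one] at hk'))
  obtain ⟨u, hu, huz⟩ : z ∈ AffineMap.lineMap p (f p) '' Set.Icc (0 : ℝ) 1 := by
    rw [← segment_eq_image_lineMap, segment_eq_Icc hp.le]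
    exact ⟨hpz, hzp.le⟩
  have hu1 : u < 1 := (lineMap_lt_right_iff_lt_one hp).mp (huz.trans_lt hzp)
  refine ⟨k + u, ?_⟩
  rw [orbitCurve, Int.floor_intCast_add, Int.fract_intCast_add,
    Int.floor_eq_zero_iff.mpr ⟨hu.1, hu1⟩, Int.fract_eq_self.mpr ⟨hu.1, hu1⟩, huz, add_zero, hy]

theorem isOrbitCurve_orbitCurve {p : ℝ} (hp : p < f p) : IsOrbitCurve f p (orbitCurve f p) :=
  ⟨orbitCurve_add_one p, range_orbitCurve hp, .inl (strictMono_orbitCurve hp)⟩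

theorem exists_isOrbitCurve (f : ℝ ≃o ℝ) (p : ℝ) : ∃ e, IsOrbitCurve f p e := by
  rcases lt_trichotomy p (f p) with hp | hp | hp
  · exact ⟨_, isOrbitCurve_orbitCurve hp⟩
  · refine ⟨fun _ ↦ p, fun _ ↦ hp, ?_, .inr (.inr fun _ _ ↦ rfl)⟩
    have horbit (n : ℤ) : (f ^ n) p = p := zpow_mem (K := MulAction.stabilizer (ℝ ≃o ℝ) p) hp.symm n
    refine (Set.range_const).trans (Set.ext fun y ↦ ⟨?_, ?_⟩)
    · rintro rfl
      exact Setoid.refl' (orbitHullSetoid f) _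
    · rintro ⟨m, n, hm, hn⟩
      exact le_antisymm (hn.trans_eq (horbit n)) ((horbit m).symm.trans_le hm)
  · have hp' : p < f⁻¹ p := f.lt_symm_apply.mpr hp
    refine ⟨fun t ↦ orbitCurve f⁻¹ p (-t), fun t ↦ ?_, ?_,
      .inr (.inl ((strictMono_orbitCurve hp').comp_strictAnti fun _ _ ↦ neg_lt_neg))⟩
    · have h := orbitCurve_add_one (f := f⁻¹) p (-(t + 1))
      rw [neg_add, neg_add_cancel_right] at h
      rw [neg_add, h]
      exact (f.apply_symm_apply _).symm
    · refine (neg_surjective.range_comp _).trans ((range_orbitCurve hp').trans ?_)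
      exact Set.ext fun y ↦ orbitHullSetoid_inv

theorem isSquare_orderIso (f : ℝ ≃o ℝ) : IsSquare f := by
  choose e he using exists_isOrbitCurve f
  let p (x : ℝ) : ℝ := (Quotient.mk (orbitHullSetoid f) x).out
  have hp (x) : orbitHullSetoid f (p x) x := Quotient.mk_out x
  have hp_congr {x y} (h : orbitHullSetoid f x y) : p x = p y :=
    congrArg Quotient.out (Quotient.sound h)
  have hex (x) : ∃ t, e (p x) t = x := (he (p x)).range_eq.ge (hp x)
  choose t ht using hex
  let g (x : ℝ) : ℝ := e (p x) (t x + 1 / 2)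
  have hg (x) : orbitHullSetoid f x (g x) :=
    Setoid.trans' _ (Setoid.symm' _ (hp x)) ((he (p x)).range_eq.le ⟨_, rfl⟩)
  have hmono : StrictMono g := by
    intro x y hxy
    by_cases h : orbitHullSetoid f x y
    · have heq : e (p x) (t y) = y := by rw [hp_congr h, ht]
      calc g x < e (p x) (t y + 1 / 2) :=
            (he (p x)).apply_add_lt ((ht x).trans_lt (hxy.trans_eq heq.symm)) _
        _ = g y := by rw [hp_congr h]
    · exact lt_of_lt_of_not_orbitHullSetoid hxy h (hg x) (hg y)
  have hsq (x) : g (g x) = f x := by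
    have heq : e (p x) (t (g x)) = g x := by rw [hp_congr (hg x), ht]
    calc g (g x) = e (p x) (t (g x) + 1 / 2) := by rw [hp_congr (hg x)]
      _ = e (p x) (t x + 1 / 2 + 1 / 2) := (he (p x)).apply_add_eq heq _
      _ = f x := by rw [add_assoc, add_halves, (he (p x)).map_add_one, ht]
  have hright : Function.RightInverse (fun y ↦ g (f.symm y)) g := fun y ↦ by
    rw [hsq, f.apply_symm_apply]
  exact ⟨hmono.orderIsoOfRightInverse g _ hright, (RelIso.ext hsq).symm⟩

end SquareRoot

section BoundedDisplacement

/-- The homeomorphisms of the plane with bounded displacement. -/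
def boundedHomeo : Subgroup (Plane ≃ₜ Plane) where
  carrier := {f | BoundedDisplacement f}
  one_mem' := ⟨0, fun w ↦ by simp⟩
  mul_mem' := by
    rintro f g ⟨C, hC⟩ ⟨C', hC'⟩
    refine ⟨C + C', fun w ↦ ?_⟩
    rw [Homeomorph.mul_apply, ← sub_add_sub_cancel _ (g w)]
    exact (norm_add_le _ _).trans (add_le_add (hC _) (hC' _))
  inv_mem' hf := hf.symm

theorem horizontalMap_mem_boundedHomeo {φ : ℝ ≃ₜ ℝ} {C : ℝ} (hφ : ∀ x, |φ x - x| ≤ C) :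
    horizontalMap φ ∈ boundedHomeo := by
  refine ⟨C, fun w ↦ ?_⟩
  have hsub : horizontalMap φ w - w = PiLp.single 2 0 (φ (w 0) - w 0) :=
    plane_ext (by simp [horizontalMap]) (by simp [horizontalMap])
  rw [hsub, PiLp.norm_single]
  exact hφ _

theorem verticalShear_mem_boundedHomeo {f : C(ℝ, ℝ)} {C : ℝ} (hf : ∀ x, |f x| ≤ C) :
    verticalShear (.ofAdd f) ∈ boundedHomeo := by
  refine ⟨C, fun w ↦ ?_⟩
  have hsub : verticalShear (.ofAdd f) w - w = PiLp.single 2 1 (f (w 0)) :=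
    plane_ext (by simp [verticalShear]) (by simp [verticalShear])
  rw [hsub, PiLp.norm_single]
  exact hf _

theorem conj_swapMap_apply (f : Plane ≃ₜ Plane) :
    MulAut.conj swapMap f = swapMap * f * swapMap :=
  Homeomorph.ext fun _ ↦ plane_ext rfl rfl

theorem swapMap_mul_mul_mem_boundedHomeo {f : Plane ≃ₜ Plane} (hf : f ∈ boundedHomeo) :
    swapMap * f * swapMap ∈ boundedHomeo := by
  obtain ⟨C, hC⟩ := hf
  have hnorm (v : Plane) : ‖swapMap v‖ = ‖v‖ := by
    rw [EuclideanSpace.norm_eq, EuclideanSpace.norm_eq, Fin.sum_univ_two, Fin.sum_univ_two,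
      add_comm]
    rfl
  have hsub (w : Plane) : (swapMap * f * swapMap) w - w = swapMap (f (swapMap w) - swapMap w) :=
    plane_ext rfl rfl
  exact ⟨C, fun w ↦ by rw [hsub, hnorm]; exact hC _⟩

theorem abs_sub_le_abs_apply_apply_sub {g : ℝ → ℝ} (hg : Monotone g) (x : ℝ) :
    |g x - x| ≤ |g (g x) - x| := by
  rcases le_total x (g x) with h | h
  · have := hg h
    rw [abs_of_nonneg (by linarith), abs_of_nonneg (by linarith)]
    linarith
  · have := hg h
    rw [abs_of_nonpos (by linarith), abs_of_nonpos (by linarith)]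
    linarith

theorem strictMono_delta0 : StrictMono delta0 := by
  refine (delta0.continuous.strictMono_of_inj delta0.injective).resolve_right fun hanti ↦ ?_
  linarith [delta0_add_one 0, hanti (lt_add_one (0 : ℝ))]

theorem exists_homeomorph_mul_self_eq_delta0 :
    ∃ σ : ℝ ≃ₜ ℝ, σ * σ = delta0 ∧ ∀ x, |σ x - x| ≤ 1 := by
  obtain ⟨σ, hσ⟩ := isSquare_orderIso
    (strictMono_delta0.orderIsoOfSurjective delta0 delta0.surjective)
  have hσσ (x) : σ (σ x) = delta0 x := (DFunLike.congr_fun hσ x).symm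
  refine ⟨σ.toHomeomorph, Homeomorph.ext hσσ, fun x ↦ ?_⟩
  calc |σ x - x| ≤ |σ (σ x) - x| := abs_sub_le_abs_apply_apply_sub σ.monotone x
    _ ≤ 1 := (hσσ x).symm ▸ abs_delta0_sub_le x

/-- The planar generators as elements of the group of homeomorphisms with bounded displacement. -/
noncomputable def boundedGenerator (i : Fin 6) : boundedHomeo :=
  ⟨planarGenerator i, boundedDisplacement_planarGenerator i⟩

/-- The predicate that `f` has a square root with bounded displacement. -/
def HasBoundedSqrt (f : Plane ≃ₜ Plane) : Prop := ∃ g ∈ boundedHomeo, g * g = f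

theorem hasBoundedSqrt_translateX (t : ℝ) : HasBoundedSqrt (translateX t) := by
  refine ⟨translateX (t / 2), ?_, ?_⟩
  · rw [translateX_eq]
    exact horizontalMap_mem_boundedHomeo (C := |t / 2|) fun x ↦
      (congrArg abs (add_sub_cancel_left x _)).le
  · rw [← sq, translateX_pow, Nat.cast_ofNat, mul_div_cancel₀ t two_ne_zero]

theorem hasBoundedSqrt_verticalShear {f : C(ℝ, ℝ)} {C : ℝ} (hf : ∀ x, |f x| ≤ C) :
    HasBoundedSqrt (verticalShear (.ofAdd f)) := by
  refine ⟨verticalShear (.ofAdd ((1 / 2 : ℝ) • f)),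
    verticalShear_mem_boundedHomeo (C := 1 / 2 * C) fun x ↦ ?_, ?_⟩
  · rw [ContinuousMap.smul_apply, smul_eq_mul, abs_mul, abs_of_pos one_half_pos]
    exact mul_le_mul_of_nonneg_left (hf x) one_half_pos.le
  · rw [← map_mul, ← ofAdd_add, ← add_smul, add_halves, one_smul]

theorem hasBoundedSqrt_translateY (t : ℝ) : HasBoundedSqrt (translateY t) :=
  translateY_eq t ▸ hasBoundedSqrt_verticalShear (C := |t|) fun _ ↦ le_rfl

theorem hasBoundedSqrt_shear (t : ℝ) : HasBoundedSqrt (shear t) := by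
  rw [shear_eq]
  refine hasBoundedSqrt_verticalShear (C := |t|) fun x ↦ ?_
  rw [ContinuousMap.smul_apply, smul_eq_mul, abs_mul]
  exact mul_le_of_le_one_right (abs_nonneg t) (abs_gamma0_le x)

theorem hasBoundedSqrt_deltaMap : HasBoundedSqrt deltaMap := by
  obtain ⟨σ, hσ, hbound⟩ := exists_homeomorph_mul_self_eq_delta0
  exact ⟨horizontalMap σ, horizontalMap_mem_boundedHomeo hbound, by
    rw [← map_mul, hσ, deltaMap_eq]⟩

theorem HasBoundedSqrt.conj_swapMap {f : Plane ≃ₜ Plane} (hf : HasBoundedSqrt f) :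
    HasBoundedSqrt (swapMap * f * swapMap) := by
  obtain ⟨g, hg, rfl⟩ := hf
  refine ⟨swapMap * g * swapMap, swapMap_mul_mul_mem_boundedHomeo hg, ?_⟩
  rw [← conj_swapMap_apply, ← conj_swapMap_apply, map_mul]

theorem hasBoundedSqrt_planarGenerator (i : Fin 6) : HasBoundedSqrt (planarGenerator i) := by
  fin_cases i
  exacts [hasBoundedSqrt_translateX _, hasBoundedSqrt_translateY _, hasBoundedSqrt_shear _,
    hasBoundedSqrt_deltaMap, (hasBoundedSqrt_shear _).conj_swapMap,
    hasBoundedSqrt_deltaMap.conj_swapMap]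

theorem isSquare_boundedGenerator (i : Fin 6) : IsSquare (boundedGenerator i) := by
  obtain ⟨g, hg, hgi⟩ := hasBoundedSqrt_planarGenerator i
  exact ⟨⟨g, hg⟩, Subtype.ext hgi.symm⟩

end BoundedDisplacement

section Disk

/-- The embedding of the group of homeomorphisms with bounded displacement in `Homeo(D, ∂D)`. -/
noncomputable def diskHom : boundedHomeo →* homeoDiskRelBoundary :=
  MonoidHom.mk' (fun f ↦ toHomeoDisk f.1 f.2) fun f g ↦ by
    refine Subtype.ext (Homeomorph.ext fun z ↦ Subtype.ext ?_)
    change diskMap (f.1 * g.1) z = diskMap f.1 (diskMap g.1 z)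
    by_cases hz : ‖(z : Plane)‖ < 1
    · rw [diskMap_of_lt _ hz, diskMap_of_lt _ hz, diskMap_of_lt _ (norm_toDisk_lt _),
        ofDisk_toDisk, Homeomorph.mul_apply]
    · rw [diskMap_of_not_lt _ hz, diskMap_of_not_lt _ hz, diskMap_of_not_lt _ hz]

theorem ofDisk_diskHom_toDisk (f : boundedHomeo) (w : Plane) :
    ofDisk ((diskHom f).1 ⟨toDisk w, mem_closedBall_zero_iff.mpr (norm_toDisk_lt w).le⟩ : Disk) =
      f.1 w := by
  change ofDisk (diskMap f.1 (toDisk w)) = f.1 w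
  rw [diskMap_of_lt _ (norm_toDisk_lt _), ofDisk_toDisk, ofDisk_toDisk]

theorem diskHom_injective : Function.Injective diskHom := fun f g h ↦
  Subtype.ext <| Homeomorph.ext fun w ↦ by
    rw [← ofDisk_diskHom_toDisk f, h, ofDisk_diskHom_toDisk]

theorem isSquare_diskGenerator (i : Fin 6) : IsSquare (diskGenerator i) :=
  (isSquare_boundedGenerator i).map diskHom

theorem kleinSystem_diskGenerator_iff {i j k l : Fin 6} :
    KleinSystem (diskGenerator i) (diskGenerator j) (diskGenerator k) (diskGenerator l) ↔
      KleinSystem (planarGenerator i) (planarGenerator j) (planarGenerator k) (planarGenerator l) :=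
  (kleinSystem_map_iff diskHom_injective (a := boundedGenerator i) (b := boundedGenerator j)
    (c := boundedGenerator k) (d := boundedGenerator l)).trans
    (kleinSystem_map_iff boundedHomeo.subtype_injective).symm

theorem kleinSystem_diskGenerator :
    KleinSystem (diskGenerator 0) (diskGenerator 1) (diskGenerator 2) (diskGenerator 3) :=
  kleinSystem_diskGenerator_iff.mpr kleinSystem_translateX

theorem kleinSystem_diskGenerator_swap :
    KleinSystem (diskGenerator 1) (diskGenerator 0) (diskGenerator 4) (diskGenerator 5) := by
  have hX (t) : swapMap * translateX t * swapMap = translateY t :=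
    Homeomorph.ext fun _ ↦ plane_ext rfl rfl
  have hY (t) : swapMap * translateY t * swapMap = translateX t :=
    Homeomorph.ext fun _ ↦ plane_ext rfl rfl
  have h := (kleinSystem_map_iff (φ := (MulAut.conj swapMap).toMonoidHom)
    (MulAut.conj swapMap).injective).mpr kleinSystem_translateX
  simp only [MulEquiv.toMonoidHom_eq_coe, MonoidHom.coe_coe, conj_swapMap_apply, hX, hY] at h
  exact kleinSystem_diskGenerator_iff.mpr h

theorem diskGenerator_zero_pow_six_ne_one : diskGenerator 0 ^ 6 ≠ 1 := by
  intro h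
  have hpow : boundedGenerator 0 ^ 6 = 1 := diskHom_injective (by rw [map_pow, map_one]; exact h)
  have htranslate : translateX ((6 : ℕ) * (1 / 12)) = 1 :=
    (translateX_pow (1 / 12) 6).symm.trans (congrArg boundedHomeo.subtype hpow)
  have hzero := congrArg (fun f : Plane ≃ₜ Plane ↦ f 0 0) htranslate
  norm_num [translateX] at hzero

end Disk

theorem theorem2 :
    (∃ r : Fin 6 → homeoDiskRelBoundary, ∀ i, r i ^ 2 = diskGenerator i) ∧
      ∀ r : Fin 6 → homeoDiskRelBoundary, (∀ i, r i ^ 2 = diskGenerator i) →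
        (Subgroup.closure (Set.range r)).FG ∧
          ¬ ∃ ρ : Subgroup.closure (Set.range r) →* (Circle ≃ₜ Circle),
            Function.Injective ρ := by
  refine ⟨?_, fun r hr ↦ ⟨?_, ?_⟩⟩
  · choose r hr using isSquare_diskGenerator
    exact ⟨r, fun i ↦ (sq (r i)).trans (hr i).symm⟩
  · exact (Subgroup.fg_iff _).mpr ⟨_, rfl, Set.finite_range r⟩
  · rintro ⟨ρ, hρ⟩
    let x (i : Fin 6) : Subgroup.closure (Set.range r) :=
      ⟨r i, Subgroup.subset_closure (Set.mem_range_self i)⟩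
    choose F hF using fun i ↦ exists_circleHomeo_eq_sq (ρ (x i))
    have hFx (i) : circleHomeo (F i) = ρ (x i ^ 2) := by rw [hF, map_pow]
    have hx (i) : (Subgroup.closure (Set.range r)).subtype (x i ^ 2) = diskGenerator i := hr i
    have hsystem {i j k l}
        (h : KleinSystem (diskGenerator i) (diskGenerator j) (diskGenerator k) (diskGenerator l)) :
        KleinSystem (circleHomeo (F i)) (circleHomeo (F j)) (circleHomeo (F k))
          (circleHomeo (F l)) := by
      simp only [hFx, kleinSystem_map_iff hρ]
      simpa only [← hx, kleinSystem_map_iff (Subgroup.subtype_injective _)] using h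
    have hpow : circleHomeo (F 0) ^ 6 = 1 := pow_six_eq_one_of_kleinSystem
      (hsystem kleinSystem_diskGenerator) (hsystem kleinSystem_diskGenerator_swap)
    have hone : (x 0 ^ 2) ^ 6 = 1 := hρ (by rw [map_pow, ← hFx, hpow, map_one])
    refine diskGenerator_zero_pow_six_ne_one ?_
    rw [← hx, ← map_pow, hone, map_one]
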